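/- **Mednykh formula with insertions.** Let $G$ be a finite group, let $g,r\ge 0$ be integers, and let $\Sigma'$ be a compact connected orientable surface of genus $g$ with $r$ boundary circles $C_1,\dots,C_r$ (that is, $\Sigma'$ is homeomorphic to the standard such surface), the $C_j$ being coherently oriented as the boundary of $\Sigma'$. Let $x\in\Sigma'$, and for $j=1,\dots,r$ let $\ell_j$ be a loop based at $x$ that is freely homotopic to $C_j$. For $\gamma_1,\dots,\gamma_r\in G$ let $O(\gamma_j)$ denote the conjugacy class of $\gamma_j$ and put $$X_G(x,\Sigma,\gamma_1,\dots,\gamma_r)=\{\varphi\in \mathrm{Hom}(\pi_1(\Sigma',x),G)\;:\;\varphi([\ell_j])\in O(\gamma_j)\text{ for } j=1,\dots,r\},$$ the set of flat $G$-bundles on $\Sigma'$ framed at $x$ whose holonomy along $\ell_j$ lies in $O(\gamma_j)$. Let $\widehat G$ be the set of isomorphism classes of irreducible finite-dimensional complex representations of $G$, and let $\chi_\pi$ be the character of $\pi\in\widehat G$. Then $\widehat G$ and $X_G(x,\Sigma,\gamma_1,\dots,\gamma_r)$ are finite, and $$\frac{|X_G(x,\Sigma,\gamma_1,\dots,\gamma_r)|}{|G|}=|G|^{2g-2}\prod_{j=1}^r|O(\gamma_j)|\sum_{\pi\in\widehat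 G}\frac{\prod_{j=1}^r\chi_\pi(\gamma_j)}{(\dim\pi)^{2g-2+r}}.$$ -/

import Mathlib

open scoped unitInterval

/-! ### The compact orientable surface of genus `g` with `r` boundary circles

It is the closed unit disc, seen as a polygon with `2 + 4 g + 3 r` sides whose sides are glued in
pairs according to the boundary word
`s s⁻¹ (a₁ b₁ a₁⁻¹ b₁⁻¹) ⋯ (a_g b_g a_g⁻¹ b_g⁻¹) (c₁ m₁ c₁⁻¹) ⋯ (c_r m_r c_r⁻¹)`.
The sides `m₁, …, m_r` are not glued to any other side: they become the boundary circles.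
The pair `s s⁻¹` does not change the surface; it is there so that the same word
also gives the sphere (`g = r = 0`), the closed disc, etc. -/

namespace Surface

/-- The closed unit disc of the complex plane. -/
abbrev Disc : Type := Metric.closedBall (0 : ℂ) 1

/-- The number of sides of the polygon. -/
def numSides (g r : ℕ) : ℕ := 2 + 4 * g + 3 * r

/-- The point at parameter `t ∈ [0, 1]` on the `k`-th side, `k = 0, 1, …, numSides g r - 1`, of the
polygon; sides are traversed counterclockwise. -/
noncomputable def side (g r k : ℕ) (t : I) : Disc :=
  ⟨Complex.exp ((2 * Real.pi * (((k : ℝ) + (t : ℝ)) / (numSides g r : ℝ)) : ℝ) * Complex.I), by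
    rw [mem_closedBall_zero_iff, Complex.norm_exp_ofReal_mul_I]⟩

/-- The gluing of the sides: a side labelled by a letter is identified with the side labelled
by the inverse letter, with orientation reversed. The sides are numbered in the order of
the word: `s s⁻¹` are `0, 1`; `aᵢ bᵢ aᵢ⁻¹ bᵢ⁻¹` are `2 + 4 i, …, 2 + 4 i + 3`; `cⱼ mⱼ cⱼ⁻¹` are
`2 + 4 g + 3 j, …, 2 + 4 g + 3 j + 2`. -/
inductive Glue (g r : ℕ) : Disc → Disc → Prop
  | s (t : I) : Glue g r (side g r 0 t) (side g r 1 (σ t))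
  | a (i : Fin g) (t : I) :
      Glue g r (side g r (2 + 4 * i) t) (side g r (2 + 4 * i + 2) (σ t))
  | b (i : Fin g) (t : I) :
      Glue g r (side g r (2 + 4 * i + 1) t) (side g r (2 + 4 * i + 3) (σ t))
  | c (j : Fin r) (t : I) :
      Glue g r (side g r (2 + 4 * g + 3 * j) t) (side g r (2 + 4 * g + 3 * j + 2) (σ t))

/-- The standard compact connected orientable surface of genus `g` with `r` boundary circles: the
quotient space of the disc by the equivalence relation generated by the gluing. -/
def Standard (g r : ℕ) : Type := Quot (Glue g r)

instance (g r : ℕ) : TopologicalSpace (Standard g r) :=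
  inferInstanceAs (TopologicalSpace (Quot (Glue g r)))

/-- The quotient map from the polygon to the surface. -/
def proj (g r : ℕ) (d : Disc) : Standard g r := Quot.mk (Glue g r) d

theorem continuous_proj (g r : ℕ) : Continuous (proj g r) := continuous_quot_mk

theorem continuous_side (g r k : ℕ) : Continuous (side g r k) := by
  unfold side
  fun_prop

theorem side_one (g r k : ℕ) : side g r k 1 = side g r (k + 1) 0 := by
  simp [side]

/-- The `j`-th boundary circle, run through once along the side `mⱼ`. All the
sides `mⱼ` are traversed counterclockwise, so the boundary circles are coherently oriented. -/
noncomputable def boundaryLoop (g r : ℕ) (j : Fin r) :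
    Path (proj g r (side g r (2 + 4 * g + 3 * j + 1) 0))
      (proj g r (side g r (2 + 4 * g + 3 * j + 1) 0)) where
  toFun t := proj g r (side g r (2 + 4 * g + 3 * j + 1) t)
  continuous_toFun := (continuous_proj g r).comp (continuous_side g r _)
  source' := rfl
  target' := by
    have h : proj g r (side g r (2 + 4 * g + 3 * j) 1)
        = proj g r (side g r (2 + 4 * g + 3 * j + 2) (σ 1)) := Quot.sound (Glue.c j 1)
    rw [unitInterval.symm_one, side_one] at h
    rw [side_one, h]

/-- Two loops (with possibly different base points) are freely homotopic: they are joined by a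
homotopy through loops whose base point may move. -/
def FreelyHomotopic {X : Type*} [TopologicalSpace X] {x y : X} (p : Path x x) (q : Path y y) :
    Prop :=
  ∃ H : C(I × I, X), (∀ t, H (0, t) = p t) ∧ (∀ t, H (1, t) = q t) ∧ ∀ s, H (s, 0) = H (s, 1)

end Surface

/-- The set of homomorphisms `π₁(X, x) → G` (that is, of flat `G`-bundles
framed at `x`) whose holonomy along `ℓ j` is in the conjugacy class of `γ j` for each `j`. -/
def holonomyHoms {G : Type*} [Group G] {X : Type*} [TopologicalSpace X] {x : X} {r : ℕ}
    (ℓ : Fin r → Path x x) (γ : Fin r → G) : Set (FundamentalGroup X x →* G) :=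
  {φ | ∀ j, φ (FundamentalGroup.fromPath (Path.Homotopic.Quotient.mk (ℓ j)))
    ∈ conjugatesOf (γ j)}

/-! ### Isomorphism classes of irreducible complex representations -/

/-- Isomorphism of irreducible finite-dimensional complex representations of `G`. -/
def irrepSetoid (G : Type*) [Group G] :
    Setoid {V : FDRep ℂ G // CategoryTheory.Simple V} where
  r V W := Nonempty (V.1 ≅ W.1)
  iseqv :=
    ⟨fun V => ⟨CategoryTheory.Iso.refl V.1⟩, fun ⟨e⟩ => ⟨e.symm⟩, fun ⟨e⟩ ⟨f⟩ => ⟨e.trans f⟩⟩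

/-- The set of isomorphism classes of irreducible finite-dimensional complex representations. -/
def IrrepClass (G : Type*) [Group G] := Quotient (irrepSetoid G)

namespace IrrepClass

/-- The dimension of an isomorphism class of irreducible representations. -/
noncomputable def dim {G : Type*} [Group G] (π : IrrepClass G) : ℕ :=
  Quotient.lift (s := irrepSetoid G) (fun V => Module.finrank ℂ V.1)
    (fun _ _ ⟨e⟩ => (FDRep.isoToLinearEquiv e).finrank_eq) π

/-- The character of an isomorphism class of irreducible representations. -/
noncomputable def character {G : Type*} [Group G] (π : IrrepClass G) : G → ℂ :=
  Quotient.lift (s := irrepSetoid G) (fun V => V.1.character)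
    (fun _ _ ⟨e⟩ => FDRep.char_iso e) π

end IrrepClass

/-! The proof has a topological half, which turns framed flat bundles into solutions of one equation
in `G`, and a character-theoretic half, which counts the solutions.

Topology. Pulled back to the contractible polygon, a flat bundle is trivial, so it is recorded by
its transports from `x` to the vertices. Comparing each vertex with a chosen representative of its
glued class gives elements `α k`, the holonomies of loops at `x`. Gluing side `k` to side `k'`
forces `(α k)⁻¹ * α (k' + 1) = (α (k + 1))⁻¹ * α k'`. Solving these equations around the polygon
leaves two free elements for each handle, one for each boundary circle, and a single closing
relation (`Surface.IsVertexSystem.relation`). No presentation of the fundamental group is needed.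
The data determine the bundle because every path in the surface is homotopic to a product of images
of paths in the polygon (`Surface.piecewiseLiftable`): the interior, the vertices and the sides have
saturated neighbourhoods that deform, compatibly with the gluing, onto discrete sets. Conversely, a
solution prescribes locally constant frames on these neighbourhoods; they define a covering with
fibre `G`, whose monodromy is the desired holonomy (`exists_pathHom_of_frames`). This gives
`Surface.exists_bijective_holonomyHoms`.

Counting. The regular character `∑ dim π * χ_π` detects whether the word `w` of the relation equals
`1`. In an irreducible representation of dimension `d`, the sum of `ρ(w)` over all tuples factors
into scalars by Schur's lemma: `(|G| / d) ^ 2` for each handle and `|O(γ_j)| χ(γ_j) / d` for each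
boundary circle. Taking traces gives `card_surfaceRelation`. -/

namespace FDRep

/-! ### Central operators on irreducible representations -/

open CategoryTheory

/-- A monomorphism into `V` is injective with invariant range; if it is nonzero the range must be
everything. -/
theorem simple_of_invariant_submodule {G : Type*} [Group G] (V : FDRep ℂ G) [Nontrivial V]
    (h : ∀ p : Submodule ℂ V, (∀ g, ∀ v ∈ p, V.ρ g v ∈ p) → p = ⊥ ∨ p = ⊤) : Simple V := by
  refine ⟨fun {W} f _ => ⟨?_, fun hf => ?_⟩⟩
  · rintro hi rfl
    obtain ⟨v, w, hvw⟩ := exists_pair_ne V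
    have key : ∀ u : V, u = 0 := by
      intro u
      have h1 := congrArg (fun φ : V ⟶ V => φ.hom.hom.hom u) (IsIso.inv_hom_id (0 : W ⟶ V))
      simpa using h1.symm
    exact hvw ((key v).trans (key w).symm)
  · have hmono : Mono ((forget₂ (FDRep ℂ G) (Rep ℂ G)).map f) := inferInstance
    have hinj : Function.Injective f.hom.hom.hom := (Rep.mono_iff_injective _).1 hmono
    have hcomm : ∀ g w, f.hom.hom.hom (W.ρ g w) = V.ρ g (f.hom.hom.hom w) := by
      intro g w
      exact congrArg (fun φ : W.V ⟶ V.V => φ.hom.hom w) (f.comm g)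
    have hsurj : Function.Surjective f.hom.hom.hom := by
      rcases h (LinearMap.range f.hom.hom.hom) (by
        rintro g _ ⟨w, rfl⟩
        exact ⟨W.ρ g w, hcomm g w⟩) with h0 | h1
      · exfalso
        apply hf
        ext v
        exact congrArg (fun T => T v) (LinearMap.range_eq_bot.1 h0)
      · exact LinearMap.range_eq_top.1 h1
    have : IsIso f.hom := by
      let e := LinearEquiv.ofBijective f.hom.hom.hom ⟨hinj, hsurj⟩
      have : f.hom = (LinearEquiv.toFGModuleCatIso e).hom := rfl
      rw [this]
      infer_instance
    infer_instance

/-- Schur's lemma, with the commuting linear map regarded as an endomorphism in `FDRep`. -/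
theorem exists_scalar_of_commute {G : Type*} [Group G] (V : FDRep ℂ G) [Simple V]
    (T : V →ₗ[ℂ] V) (hT : ∀ g v, T (V.ρ g v) = V.ρ g (T v)) : ∃ c : ℂ, T = c • LinearMap.id := by
  let f : V ⟶ V := ⟨InducedCategory.homMk (ModuleCat.ofHom T), fun g => by
    ext v
    exact hT g v⟩
  obtain ⟨c, hc⟩ := endomorphism_simple_eq_smul_id ℂ f
  refine ⟨c, ?_⟩
  ext v
  exact (congrArg (fun φ : V ⟶ V => φ.hom.hom.hom v) hc).symm

theorem finrank_ne_zero {G : Type*} [Group G] (V : FDRep ℂ G) [Simple V] :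
    (Module.finrank ℂ V : ℂ) ≠ 0 := by
  intro h
  have h' : Module.finrank ℂ V = 0 := by exact_mod_cast h
  have hs : Subsingleton V := Module.finrank_zero_iff.1 h'
  apply id_nonzero V
  ext v
  exact Subsingleton.elim _ _

/-- An operator commuting with an irreducible representation is the scalar given by its trace. -/
theorem eq_trace_smul_of_commute {G : Type*} [Group G] (V : FDRep ℂ G) [Simple V]
    (T : V →ₗ[ℂ] V) (hT : ∀ g v, T (V.ρ g v) = V.ρ g (T v)) :
    T = (LinearMap.trace ℂ V T / Module.finrank ℂ V) • (1 : V →ₗ[ℂ] V) := by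
  obtain ⟨c, hc⟩ := exists_scalar_of_commute V T hT
  have ht := congrArg (LinearMap.trace ℂ V) hc
  rw [map_smul, LinearMap.trace_id, smul_eq_mul] at ht
  rw [ht, mul_div_cancel_right₀ _ (finrank_ne_zero V), hc]
  rfl

theorem rho_mul_apply {G : Type*} [Group G] (V : FDRep ℂ G) (g h : G) (v : V) :
    V.ρ g (V.ρ h v) = V.ρ (g * h) v := by
  rw [map_mul]
  rfl

/-- A central sum acts on an irreducible representation by a scalar, computed by the trace. -/
theorem sum_smul_rho_eq {G : Type*} [Group G] [Fintype G] (V : FDRep ℂ G) [Simple V]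
    (f : G → ℂ) (hf : ∀ x y, f (x * y * x⁻¹) = f y) :
    ∑ x, f x • V.ρ x =
      ((∑ x, f x * V.character x) / Module.finrank ℂ V) • (1 : V →ₗ[ℂ] V) := by
  rw [eq_trace_smul_of_commute V (∑ x, f x • V.ρ x)]
  · simp only [map_sum, map_smul, smul_eq_mul]
    rfl
  · intro g v
    simp only [LinearMap.sum_apply, LinearMap.smul_apply, map_sum, map_smul, rho_mul_apply]
    rw [← Equiv.sum_comp (MulAut.conj g).toEquiv]
    refine Finset.sum_congr rfl fun x _ => ?_
    simp [MulAut.conj_apply, hf]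

/-- The sum of the commutators acts on an irreducible representation as `(|G| / d) ^ 2`. -/
theorem sum_rho_commutator {G : Type*} [Group G] [Fintype G] (V : FDRep ℂ G) [Simple V] :
    ∑ x : G × G, V.ρ (x.2⁻¹ * x.1⁻¹ * x.2 * x.1) =
      ((Nat.card G : ℂ) / Module.finrank ℂ V) ^ 2 • (1 : V →ₗ[ℂ] V) := by
  -- For fixed `a` the conjugates of `a⁻¹` sum to a scalar operator. The remaining sum over `a` is
  -- evaluated by the orthogonality of the character with itself.
  have h1 : ∀ a : G, ∑ b : G, V.ρ (b⁻¹ * a⁻¹ * b) =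
      ((Nat.card G : ℂ) / Module.finrank ℂ V * V.character a⁻¹) • (1 : V →ₗ[ℂ] V) := by
    intro a
    rw [eq_trace_smul_of_commute V (∑ b : G, V.ρ (b⁻¹ * a⁻¹ * b))]
    · have h2 : ∀ b : G, LinearMap.trace ℂ V (V.ρ (b⁻¹ * a⁻¹ * b)) = V.character a⁻¹ := by
        intro b
        have := V.char_conj a⁻¹ b⁻¹
        rwa [inv_inv] at this
      simp only [map_sum, h2, Finset.sum_const, Finset.card_univ, nsmul_eq_mul,
        Nat.card_eq_fintype_card]
      congr 1
      ring
    · intro g v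
      simp only [LinearMap.sum_apply, map_sum, rho_mul_apply]
      conv_rhs => rw [← Equiv.sum_comp (Equiv.mulRight g)]
      refine Finset.sum_congr rfl fun x _ => ?_
      simp [mul_assoc]
  rw [Fintype.sum_prod_type]
  have h3 : ∀ a : G, ∑ b : G, V.ρ (b⁻¹ * a⁻¹ * b * a) =
      ((Nat.card G : ℂ) / Module.finrank ℂ V) • (V.character a⁻¹ • V.ρ a) := by
    intro a
    simp only [map_mul V.ρ _ a]
    rw [← Finset.sum_mul, h1, smul_mul_assoc, one_mul, mul_smul]
  have hinv : Invertible (Nat.card G : ℂ) := invertibleOfNonzero (by simp)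
  have horth := FDRep.char_orthonormal V V
  rw [if_pos ⟨Iso.refl V⟩, inv_mul_eq_one₀ (by simp)] at horth
  simp only [h3, ← Finset.smul_sum]
  rw [sum_smul_rho_eq V (fun a => V.character a⁻¹) (by
    intro x y
    have := V.char_conj y⁻¹ x
    simpa [mul_assoc] using this)]
  simp only [mul_comm (V.character _⁻¹)]
  rw [← horth, smul_smul, pow_two]

/-- The class sum acts on an irreducible representation by a scalar. -/
theorem sum_rho_conjugates {G : Type*} [Group G] (V : FDRep ℂ G) [Simple V]
    (γ : G) [Fintype (conjugatesOf γ)] :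
    ∑ x : conjugatesOf γ, V.ρ x =
      ((conjugatesOf γ).ncard * V.character γ / Module.finrank ℂ V : ℂ) •
        (1 : V →ₗ[ℂ] V) := by
  rw [eq_trace_smul_of_commute V (∑ x : conjugatesOf γ, V.ρ x)]
  · have h2 : ∀ x : conjugatesOf γ, LinearMap.trace ℂ V (V.ρ x) = V.character γ := by
      rintro ⟨x, hx⟩
      obtain ⟨c, rfl⟩ := isConj_iff.1 hx
      exact V.char_conj γ c
    simp only [map_sum, h2, Finset.sum_const, Finset.card_univ, nsmul_eq_mul]
    rw [← Nat.card_coe_set_eq, Nat.card_eq_fintype_card]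
  · intro g v
    simp only [LinearMap.sum_apply, map_sum, rho_mul_apply]
    have hc : ∀ g x : G, x ∈ conjugatesOf γ → g * x * g⁻¹ ∈ conjugatesOf γ := fun g x hx =>
      IsConj.trans hx (isConj_iff.2 ⟨g, rfl⟩)
    let e : conjugatesOf γ ≃ conjugatesOf γ :=
      { toFun := fun x => ⟨g * x * g⁻¹, hc g x x.2⟩
        invFun := fun x => ⟨g⁻¹ * x * g, by simpa using hc g⁻¹ x x.2⟩
        left_inv := fun x => by ext; simp [mul_assoc]
        right_inv := fun x => by ext; simp [mul_assoc] }
    rw [← Equiv.sum_comp e]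
    refine Finset.sum_congr rfl fun x _ => ?_
    simp [e]

end FDRep

/-! ### Irreducible representations and the group algebra -/

/-- Bridge from ring theory to `FDRep`: the action on a simple left ideal is transported to
coordinates, and invariant subspaces of the coordinates pull back to submodules. -/
theorem exists_simple_FDRep_of_submodule {G : Type*} [Group G] [Finite G]
    (M : Submodule (MonoidAlgebra ℂ G) (MonoidAlgebra ℂ G))
    [IsSimpleModule (MonoidAlgebra ℂ G) M] :
    ∃ (V : FDRep ℂ G) (_ : CategoryTheory.Simple V) (e : M ≃ₗ[ℂ] V),
      ∀ g m, e (MonoidAlgebra.of ℂ G g • m) = V.ρ g (e m) := by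
  have : Module.Finite ℂ (MonoidAlgebra ℂ G) :=
    Module.Finite.of_basis (MonoidAlgebra.basis G ℂ)
  have : Module.Finite ℂ M :=
    inferInstanceAs (Module.Finite ℂ (M.restrictScalars ℂ))
  let e := (Module.finBasis ℂ M).equivFun
  let ρ : G →* ((Fin (Module.finrank ℂ M) → ℂ) →ₗ[ℂ] (Fin (Module.finrank ℂ M) → ℂ)) :=
    (e.conjRingEquiv : Module.End ℂ M →* _).comp
      (((Algebra.lsmul ℂ ℂ M : MonoidAlgebra ℂ G →ₐ[ℂ] Module.End ℂ M) : MonoidAlgebra ℂ G →* _).comp (MonoidAlgebra.of ℂ G))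
  have hρ : ∀ g m, e (MonoidAlgebra.of ℂ G g • m) = ρ g (e m) := by
    intro g m
    simp [ρ, LinearEquiv.conjRingEquiv]
  have hnt : Nontrivial M := IsSimpleModule.nontrivial (MonoidAlgebra ℂ G) M
  have hnt' : Nontrivial (FDRep.of ρ) := e.symm.toEquiv.nontrivial
  refine ⟨FDRep.of ρ, FDRep.simple_of_invariant_submodule _ fun p hp => ?_, e, hρ⟩
  let q : Submodule (MonoidAlgebra ℂ G) M :=
    { carrier := {m | e m ∈ p}
      add_mem' := fun {a b} ha hb => by
        simpa using p.add_mem ha hb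
      zero_mem' := by simp
      smul_mem' := fun c m hm => by
        induction c using MonoidAlgebra.induction_on with
        | of g =>
          have := hp g (e m) hm
          rw [Set.mem_ofPred_eq, hρ]
          exact this
        | add a b ha hb =>
          rw [Set.mem_ofPred_eq, add_smul, map_add]
          exact p.add_mem ha hb
        | smul r a ha =>
          rw [Set.mem_ofPred_eq, smul_assoc, map_smul]
          exact p.smul_mem r ha }
  rcases eq_bot_or_eq_top q with h | h
  · left
    rw [Submodule.eq_bot_iff]
    intro x hx
    have : e.symm x ∈ q := by
      change e (e.symm x) ∈ p
      simpa using hx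
    rw [h, Submodule.mem_bot] at this
    simpa using this
  · right
    rw [Submodule.eq_top_iff']
    intro x
    have : e.symm x ∈ q := by rw [h]; trivial
    change e (e.symm x) ∈ p at this
    simpa using this

/-- The irreducible representations separate the elements of the group algebra. -/
theorem eq_zero_of_forall_simple {G : Type*} [Group G] [Fintype G] (f : G → ℂ)
    (h : ∀ V : FDRep ℂ G, CategoryTheory.Simple V → ∑ x, f x • V.ρ x = 0) : f = 0 := by
  classical
  let a : MonoidAlgebra ℂ G := ∑ x, f x • MonoidAlgebra.of ℂ G x
  have : NeZero (Nat.card G : ℂ) := ⟨by simp⟩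
  have key : ∀ M : Submodule (MonoidAlgebra ℂ G) (MonoidAlgebra ℂ G),
      IsSimpleModule (MonoidAlgebra ℂ G) M → ∀ m ∈ M, a * m = 0 := by
    intro M hM m hm
    obtain ⟨V, hV, e, he⟩ := exists_simple_FDRep_of_submodule M
    have h1 : e (a • ⟨m, hm⟩) = 0 := by
      have h2 := congrArg (fun T : V →ₗ[ℂ] V => T (e ⟨m, hm⟩)) (h V hV)
      simp only [LinearMap.sum_apply, LinearMap.smul_apply, LinearMap.zero_apply] at h2
      rw [← h2, Finset.sum_smul, map_sum]
      refine Finset.sum_congr rfl fun x _ => ?_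
      rw [smul_assoc, map_smul, he]
    have h3 := (LinearEquiv.map_eq_zero_iff e).1 h1
    exact congrArg Subtype.val h3
  -- By Maschke's theorem the group algebra is the sum of its simple left ideals, so `1` is a sum of
  -- elements killed by `a`.
  have h1 : a * 1 = 0 := by
    have hmem : (1 : MonoidAlgebra ℂ G) ∈
        sSup {m : Submodule (MonoidAlgebra ℂ G) (MonoidAlgebra ℂ G) |
          IsSimpleModule (MonoidAlgebra ℂ G) m} := by
      rw [IsSemisimpleModule.sSup_simples_eq_top]
      trivial
    rw [sSup_eq_iSup'] at hmem
    exact Submodule.iSup_induction _ (motive := fun m => a * m = 0) hmem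
      (fun i x hx => key i.1 i.2 x hx) (mul_zero a)
      (fun x y hx hy => by rw [mul_add, hx, hy, add_zero])
  rw [mul_one] at h1
  ext x
  have h2 := congrArg (fun b => (MonoidAlgebra.basis G ℂ).repr b x) h1
  simpa [a, MonoidAlgebra.of_apply, ← MonoidAlgebra.basis_apply, Finsupp.single_apply] using h2

/-- Independent indices let the sum of products factor in order, even without commutativity; the
factors are scalars. -/
theorem sum_prod_ofFn_eq_smul {R : Type*} [Ring R] [Algebra ℂ R] :
    ∀ {n : ℕ} {ι : Fin n → Type*} [∀ i, Fintype (ι i)] (F : ∀ i, ι i → R) (c : Fin n → ℂ),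
      (∀ i, ∑ y, F i y = c i • (1 : R)) →
      ∑ x : ∀ i, ι i, (List.ofFn fun i => F i (x i)).prod = (∏ i, c i) • (1 : R)
  | 0, ι, _, F, c, _ => by simp
  | n + 1, ι, _, F, c, h => by
    rw [← Equiv.sum_comp (Fin.consEquiv ι), Fintype.sum_prod_type]
    simp only [Fin.consEquiv_apply, List.ofFn_succ, Fin.cons_zero, Fin.cons_succ, List.prod_cons]
    simp only [← Finset.mul_sum]
    rw [sum_prod_ofFn_eq_smul (fun i => F i.succ) (fun i => c i.succ) fun i => h i.succ,
      ← Finset.sum_mul, h 0, Fin.prod_univ_succ, smul_mul_smul_comm, one_mul]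

theorem sum_prod_reverse_ofFn_eq_smul {R : Type*} [Ring R] [Algebra ℂ R] :
    ∀ {n : ℕ} {ι : Fin n → Type*} [∀ i, Fintype (ι i)] (F : ∀ i, ι i → R) (c : Fin n → ℂ),
      (∀ i, ∑ y, F i y = c i • (1 : R)) →
      ∑ x : ∀ i, ι i, (List.ofFn fun i => F i (x i)).reverse.prod = (∏ i, c i) • (1 : R)
  | 0, ι, _, F, c, _ => by simp
  | n + 1, ι, _, F, c, h => by
    rw [← Equiv.sum_comp (Fin.consEquiv ι), Fintype.sum_prod_type_right]
    simp only [Fin.consEquiv_apply, List.ofFn_succ, Fin.cons_zero, Fin.cons_succ,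
      List.reverse_cons, List.prod_append, List.prod_singleton]
    simp only [← Finset.mul_sum, ← Finset.sum_mul]
    rw [sum_prod_reverse_ofFn_eq_smul (fun i => F i.succ) (fun i => c i.succ) fun i => h i.succ,
      h 0, Fin.prod_univ_succ, smul_mul_smul_comm, one_mul, mul_comm (c 0)]

/-! ### Orthogonality, finiteness and the regular character -/

namespace IrrepClass

open CategoryTheory

theorem exists_rep {G : Type*} [Group G] (π : IrrepClass G) :
    ∃ (V : FDRep ℂ G) (_ : Simple V), π.dim = Module.finrank ℂ V ∧ π.character = V.character ∧
      π = Quotient.mk (irrepSetoid G) ⟨V, ‹_›⟩ := by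
  induction π using Quotient.inductionOn with
  | h V => exact ⟨V.1, V.2, rfl, rfl, rfl⟩

theorem sum_character_mul {G : Type*} [Group G] [Fintype G] (π π' : IrrepClass G)
    [Decidable (π = π')] :
    ∑ x, π.character x * π'.character x⁻¹ = if π = π' then (Nat.card G : ℂ) else 0 := by
  obtain ⟨V, hV, -, hc, h⟩ := π.exists_rep
  obtain ⟨W, hW, -, hc', h'⟩ := π'.exists_rep
  have hinv : Invertible (Nat.card G : ℂ) := invertibleOfNonzero (by simp)
  have horth := FDRep.char_orthonormal V W
  rw [hc, hc']
  have hiff : π = π' ↔ Nonempty (V ≅ W) := by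
    rw [h, h']
    exact Quotient.eq (r := irrepSetoid G)
  have h0 : (Nat.card G : ℂ) ≠ 0 := by simp
  by_cases hp : π = π'
  · rw [if_pos hp]
    rw [if_pos (hiff.1 hp), inv_mul_eq_one₀ h0] at horth
    exact horth.symm
  · rw [if_neg hp]
    rw [if_neg fun h => hp (hiff.2 h)] at horth
    exact (mul_eq_zero.1 horth).resolve_left (inv_ne_zero h0)

/-- Orthogonality makes the characters linearly independent in the finite-dimensional space `G → ℂ`.
-/
theorem finite (G : Type*) [Group G] [Finite G] : Finite (IrrepClass G) := by
  classical
  have := Fintype.ofFinite G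
  have hli : LinearIndependent ℂ (fun π : IrrepClass G => π.character) := by
    rw [linearIndependent_iff']
    intro s c hs π hπ
    have h1 : ∑ x, (∑ π' ∈ s, c π' • π'.character) x * π.character x⁻¹ = 0 := by
      rw [hs]
      simp
    simp only [Finset.sum_apply, Pi.smul_apply, smul_eq_mul, Finset.sum_mul] at h1
    rw [Finset.sum_comm] at h1
    simp only [mul_assoc, ← Finset.mul_sum, sum_character_mul] at h1
    simpa [hπ] using h1
  exact hli.finite_of_isNoetherian

/-- The character of the regular representation. -/
theorem sum_dim_mul_character {G : Type*} [Group G] [Fintype G] [Fintype (IrrepClass G)]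
    [DecidableEq G] (x : G) :
    ∑ π : IrrepClass G, (π.dim : ℂ) * π.character x = if x = 1 then (Nat.card G : ℂ) else 0 := by
  classical
  -- A class function, so it acts on each irreducible representation by a scalar. Orthogonality
  -- makes the scalar zero, since both terms contribute `|G|` times the dimension.
  let f : G → ℂ := fun x =>
    (if x = 1 then (Nat.card G : ℂ) else 0) - ∑ π : IrrepClass G, (π.dim : ℂ) * π.character x⁻¹
  have hf : f = 0 := by
    refine eq_zero_of_forall_simple f fun V hV => ?_
    rw [FDRep.sum_smul_rho_eq V f]
    · have : ∑ x, f x * V.character x = 0 := by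
        let π₀ : IrrepClass G := Quotient.mk (irrepSetoid G) ⟨V, hV⟩
        have hch : V.character = π₀.character := rfl
        have hd : π₀.dim = Module.finrank ℂ V := rfl
        simp only [f, sub_mul, Finset.sum_sub_distrib, ite_mul, zero_mul, Finset.sum_ite_eq',
          Finset.mem_univ, if_true, FDRep.char_one, Finset.sum_mul]
        rw [Finset.sum_comm, hch, ← hd]
        have : ∀ π : IrrepClass G, ∑ x, (π.dim : ℂ) * π.character x⁻¹ * π₀.character x =
            if π₀ = π then (π.dim : ℂ) * Nat.card G else 0 := by
          intro π
          simp only [mul_assoc, ← Finset.mul_sum, mul_comm (π.character _)]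
          rw [sum_character_mul]
          split_ifs <;> simp
        simp only [this]
        simp [mul_comm]
      rw [this]
      simp
    · intro x y
      have hc : ∀ π : IrrepClass G, π.character (x * y * x⁻¹)⁻¹ = π.character y⁻¹ := by
        intro π
        obtain ⟨V, hV, -, hc, h⟩ := π.exists_rep
        have := V.char_conj y⁻¹ x
        rw [hc]
        simpa [mul_assoc] using this
      simp only [f, hc]
      simp
  have h1 := congrFun hf x⁻¹
  simp only [f, inv_inv, Pi.zero_apply, inv_eq_one] at h1
  exact (sub_eq_zero.1 h1).symm

end IrrepClass

/-! ### Counting solutions of the surface relation -/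

/-- The number of solutions of the surface relation with boundary holonomies in given conjugacy
classes. -/
theorem card_surfaceRelation {G : Type*} [Group G] [Finite G] (g r : ℕ) (γ : Fin r → G) :
    (Nat.card {x : (Fin g → G × G) × (∀ j, conjugatesOf (γ j)) //
      (List.ofFn fun i => (x.1 i).2⁻¹ * (x.1 i).1⁻¹ * (x.1 i).2 * (x.1 i).1).reverse.prod *
        (List.ofFn fun j => (x.2 j : G)).prod = 1} : ℂ) / (Nat.card G : ℂ) =
      (Nat.card G : ℂ) ^ (2 * (g : ℤ) - 2) *
        (∏ j, ((conjugatesOf (γ j)).ncard : ℂ)) *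
        ∑ᶠ π : IrrepClass G,
          (∏ j, π.character (γ j)) / (π.dim : ℂ) ^ (2 * (g : ℤ) - 2 + (r : ℤ)) := by
  classical
  have := Fintype.ofFinite G
  have := IrrepClass.finite G
  have := Fintype.ofFinite (IrrepClass G)
  let w : (Fin g → G × G) × (∀ j, conjugatesOf (γ j)) → G := fun x =>
    (List.ofFn fun i => (x.1 i).2⁻¹ * (x.1 i).1⁻¹ * (x.1 i).2 * (x.1 i).1).reverse.prod *
        (List.ofFn fun j => (x.2 j : G)).prod
  have hG : (Nat.card G : ℂ) ≠ 0 := by simp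
  -- The regular character is `|G|` at `1` and zero elsewhere.
  have h1 : (Nat.card {x // w x = 1} : ℂ) * Nat.card G =
      ∑ π : IrrepClass G, (π.dim : ℂ) * ∑ x, π.character (w x) := by
    simp only [Finset.mul_sum]
    rw [Finset.sum_comm]
    simp only [IrrepClass.sum_dim_mul_character]
    rw [← Finset.sum_filter, Finset.sum_const, nsmul_eq_mul, Nat.card_eq_fintype_card,
      Fintype.card_subtype]
  have h2 : ∀ π : IrrepClass G, (π.dim : ℂ) * ∑ x, π.character (w x) =
      (Nat.card G : ℂ) ^ (2 * (g : ℤ)) * (∏ j, ((conjugatesOf (γ j)).ncard : ℂ)) *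
        ((∏ j, π.character (γ j)) / (π.dim : ℂ) ^ (2 * (g : ℤ) - 2 + (r : ℤ))) := by
    intro π
    obtain ⟨V, hV, hd, hc, -⟩ := π.exists_rep
    rw [hd, hc]
    have hd0 := FDRep.finrank_ne_zero V
    have h3 : ∑ x, V.ρ (w x) = ((((Nat.card G : ℂ) / Module.finrank ℂ V) ^ 2) ^ g *
        ∏ j, ((conjugatesOf (γ j)).ncard * V.character (γ j) / Module.finrank ℂ V : ℂ)) •
          (1 : V →ₗ[ℂ] V) := by
      rw [Fintype.sum_prod_type]
      simp only [w, map_mul V.ρ (List.prod _), map_list_prod, List.map_reverse, List.map_ofFn]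
      simp only [← Finset.mul_sum, ← Finset.sum_mul]
      have e1 := sum_prod_reverse_ofFn_eq_smul
        (fun (_ : Fin g) (y : G × G) => V.ρ (y.2⁻¹ * y.1⁻¹ * y.2 * y.1)) _
        (fun _ => FDRep.sum_rho_commutator V)
      have e2 := sum_prod_ofFn_eq_smul
        (fun (j : Fin r) (y : conjugatesOf (γ j)) => V.ρ y) _
        (fun j => FDRep.sum_rho_conjugates V (γ j))
      simp only [Function.comp_def]
      rw [e1, e2, smul_mul_smul_comm, one_mul]
      simp
    have h4 : ∑ x, V.character (w x) = LinearMap.trace ℂ V (∑ x, V.ρ (w x)) := by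
      rw [map_sum]
      rfl
    rw [h4, h3, map_smul, LinearMap.trace_one, Finset.prod_div_distrib, Finset.prod_mul_distrib,
      zpow_add₀ hd0, zpow_sub₀ hd0]
    simp only [Finset.prod_const, Finset.card_univ, Fintype.card_fin, smul_eq_mul, zpow_mul,
      zpow_natCast, zpow_ofNat, div_pow]
    field_simp
  rw [finsum_eq_sum_of_fintype]
  have h5 : (Nat.card {x // w x = 1} : ℂ) =
      (∑ π : IrrepClass G, (π.dim : ℂ) * ∑ x, π.character (w x)) / Nat.card G :=
    eq_div_of_mul_eq hG h1
  rw [show (Nat.card {x // _} : ℂ) = (Nat.card {x // w x = 1} : ℂ) from rfl, h5]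
  simp only [h2]
  rw [← Finset.mul_sum, zpow_sub₀ hG]
  simp only [zpow_ofNat]
  field_simp

/-! ### Holonomy as a function on homotopy classes of paths -/

open Topology Filter

/-- A multiplicative function on homotopy classes of paths, contravariant as the multiplication of
the fundamental group is. -/
structure PathHom (X G : Type*) [TopologicalSpace X] [Group G] where
  /-- The value on a homotopy class of paths. -/
  hol : ∀ {x y : X}, Path.Homotopic.Quotient x y → G
  hol_trans : ∀ {x y z : X} (p : Path.Homotopic.Quotient x y) (q : Path.Homotopic.Quotient y z),
    hol (p.trans q) = hol q * hol p

namespace PathHom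

variable {X G : Type*} [TopologicalSpace X] [Group G] (F : PathHom X G)

theorem hol_refl (x : X) : F.hol (.refl x) = 1 := by
  have h := F.hol_trans (.refl x) (.refl x)
  rw [Path.Homotopic.Quotient.refl_trans] at h
  exact left_eq_mul.1 h

theorem hol_symm {x y : X} (p : Path.Homotopic.Quotient x y) : F.hol p.symm = (F.hol p)⁻¹ := by
  have h := F.hol_trans p p.symm
  rw [Path.Homotopic.Quotient.trans_symm, F.hol_refl] at h
  exact eq_inv_of_mul_eq_one_left h.symm

/-- The value on a path. -/
def onPath {x y : X} (p : Path x y) : G := F.hol (.mk p)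

theorem onPath_trans {x y z : X} (p : Path x y) (q : Path y z) :
    F.onPath (p.trans q) = F.onPath q * F.onPath p :=
  F.hol_trans (.mk p) (.mk q)

theorem onPath_symm {x y : X} (p : Path x y) : F.onPath p.symm = (F.onPath p)⁻¹ :=
  F.hol_symm (.mk p)

/-- Pointwise equality allows end points that agree only propositionally, as happens with the images
of glued points. -/
theorem onPath_congr {x y x' y' : X} (p : Path x y) (q : Path x' y') (h : ∀ t, p t = q t) :
    F.onPath p = F.onPath q := by
  obtain rfl : x = x' := by simpa using h 0
  obtain rfl : y = y' := by simpa using h 1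
  rw [Path.ext (funext h)]

theorem onPath_eq_of_homotopic {x y : X} {p q : Path x y} (h : p.Homotopic q) :
    F.onPath p = F.onPath q :=
  congrArg F.hol (Path.Homotopic.Quotient.eq.2 h)

/-- The homomorphism from the fundamental group given by restriction to loops. -/
def toHom (x : X) : FundamentalGroup X x →* G where
  toFun p := F.hol p
  map_one' := F.hol_refl x
  map_mul' p q := F.hol_trans q p

/-- The extension of a homomorphism from the fundamental group to all paths. -/
theorem exists_toHom_eq [PathConnectedSpace X] (x : X) (φ : FundamentalGroup X x →* G) :
    ∃ F : PathHom X G, F.toHom x = φ := by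
  -- The reversed `somePath x x` in front makes `c x` trivial, so that `φ` itself is recovered on
  -- loops.
  let c (y : X) : Path.Homotopic.Quotient x y :=
    (Path.Homotopic.Quotient.mk (PathConnectedSpace.somePath x x)).symm.trans
      (.mk (PathConnectedSpace.somePath x y))
  have hc : c x = .refl x := Path.Homotopic.Quotient.symm_trans _
  refine ⟨⟨fun {y z} p => φ (FundamentalGroup.fromPath (((c y).trans p).trans (c z).symm)), ?_⟩, ?_⟩
  · intro y z w p q
    rw [← map_mul]
    congr 1
    rw [FundamentalGroup.mul_def]
    simp only [Path.Homotopic.Quotient.trans_assoc]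
    rw [← Path.Homotopic.Quotient.trans_assoc (c z).symm, Path.Homotopic.Quotient.symm_trans,
      Path.Homotopic.Quotient.refl_trans]
  · ext p
    change φ (FundamentalGroup.fromPath (((c x).trans p).trans (c x).symm)) = φ p
    congr 1
    rw [hc, Path.Homotopic.Quotient.refl_trans, ← Path.Homotopic.Quotient.mk_refl,
      ← Path.Homotopic.Quotient.mk_symm, Path.refl_symm, Path.Homotopic.Quotient.mk_refl,
      Path.Homotopic.Quotient.trans_refl]

end PathHom

/-- The two ways around a square in `X` are homotopic. -/
theorem Path.Homotopic.of_square {X : Type*} [TopologicalSpace X] {a b c d : X}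
    (K : I × I → X) (hK : Continuous K) (p : Path a b) (r : Path b d) (l : Path a c) (q : Path c d)
    (hp : ∀ t, p t = K (0, t)) (hr : ∀ t, r t = K (t, 1)) (hl : ∀ t, l t = K (t, 0))
    (hq : ∀ t, q t = K (1, t)) : (p.trans r).Homotopic (l.trans q) := by
  obtain rfl : K (0, 0) = a := by rw [← hp]; simp
  obtain rfl : K (0, 1) = b := by rw [← hp]; simp
  obtain rfl : K (1, 0) = c := by rw [← hl]; simp
  obtain rfl : K (1, 1) = d := by rw [← hr]; simp
  let P : Path ((0, 0) : I × I) (0, 1) := ⟨⟨fun t => (0, t), by fun_prop⟩, rfl, rfl⟩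
  let R : Path ((0, 1) : I × I) (1, 1) := ⟨⟨fun t => (t, 1), by fun_prop⟩, rfl, rfl⟩
  let L : Path ((0, 0) : I × I) (1, 0) := ⟨⟨fun t => (t, 0), by fun_prop⟩, rfl, rfl⟩
  let Q : Path ((1, 0) : I × I) (1, 1) := ⟨⟨fun t => (1, t), by fun_prop⟩, rfl, rfl⟩
  have : ContractibleSpace I := (convex_Icc (0 : ℝ) 1).contractibleSpace ⟨0, by simp⟩
  have h : (P.trans R).Homotopic (L.trans Q) := SimplyConnectedSpace.paths_homotopic _ _
  have h' := h.map ⟨K, hK⟩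
  simp only [Path.map_trans] at h'
  rw [show p = P.map (f := K) hK from Path.ext (funext hp),
    show r = R.map (f := K) hK from Path.ext (funext hr),
    show l = L.map (f := K) hK from Path.ext (funext hl),
    show q = Q.map (f := K) hK from Path.ext (funext hq)]
  exact h'

/-- The track of the base point during the homotopy conjugates one holonomy into the other. -/
theorem PathHom.isConj_of_freelyHomotopic {X G : Type*} [TopologicalSpace X] [Group G]
    (F : PathHom X G) {x y : X} {p : Path x x} {q : Path y y}
    (h : Surface.FreelyHomotopic p q) : IsConj (F.onPath p) (F.onPath q) := by
  obtain ⟨H, h0, h1, hs⟩ := h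
  have e0 : H (0, 0) = x := by rw [h0]; simp
  have e1 : H (1, 0) = y := by rw [h1]; simp
  let τ : Path x y := ⟨⟨fun s => H (s, 0), by fun_prop⟩, e0, e1⟩
  have := F.onPath_eq_of_homotopic (Path.Homotopic.of_square H H.continuous p τ τ q
    (fun t => (h0 t).symm) (fun t => hs t) (fun t => rfl) (fun t => (h1 t).symm))
  rw [F.onPath_trans, F.onPath_trans] at this
  exact isConj_iff.2 ⟨F.onPath τ, by rw [this]; group⟩

/-! ### Paths in a quotient that lift piecewise -/

section Liftable

variable {D X : Type*} [TopologicalSpace D] [TopologicalSpace X] {p : D → X}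

/-- The homotopy classes of paths that are products of images of paths under `p`. -/
inductive PiecewiseLiftable (hp : Continuous p) :
    ∀ {x y : X}, Path.Homotopic.Quotient x y → Prop
  | map {d d' : D} (δ : Path d d') : PiecewiseLiftable hp (.mk (δ.map hp))
  | trans {x y z : X} {q : Path.Homotopic.Quotient x y} {q' : Path.Homotopic.Quotient y z} :
      PiecewiseLiftable hp q → PiecewiseLiftable hp q' → PiecewiseLiftable hp (q.trans q')

namespace PiecewiseLiftable

theorem of_path {hp : Continuous p} {x y : X} {d d' : D} (γ : Path x y) (δ : Path d d')
    (h : ∀ t, γ t = p (δ t)) : PiecewiseLiftable hp (.mk γ) := by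
  obtain rfl : p d = x := by simpa using (h 0).symm
  obtain rfl : p d' = y := by simpa using (h 1).symm
  rw [show γ = δ.map hp from Path.ext (funext h)]
  exact map δ

theorem congr {hp : Continuous p} {x y x' y' : X} {γ : Path x y} (γ' : Path x' y')
    (h : PiecewiseLiftable hp (.mk γ)) (h' : ∀ t, γ' t = γ t) :
    PiecewiseLiftable hp (.mk γ') := by
  obtain rfl : x' = x := by simpa using h' 0
  obtain rfl : y' = y := by simpa using h' 1
  rwa [show γ' = γ from Path.ext (funext h')]

/-- It is enough to treat small paths. -/
theorem of_locally {hp : Continuous p} (hs : Function.Surjective p)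
    (h : ∀ x : X, ∃ U : Set X, IsOpen U ∧ x ∈ U ∧ ∀ {a b : X} (γ : Path a b),
      (∀ t, γ t ∈ U) → PiecewiseLiftable hp (.mk γ)) {x y : X}
    (q : Path.Homotopic.Quotient x y) : PiecewiseLiftable hp q := by
  induction q using Path.Homotopic.Quotient.ind with
  | mk γ =>
    choose U hU hxU hγU using h
    obtain ⟨t, ht0, htm, ⟨n, hn⟩, htc⟩ := exists_monotone_Icc_subset_open_cover_unitInterval
      (c := fun z : X => γ ⁻¹' U z) (fun z => (hU z).preimage γ.continuous)
      (fun s _ => Set.mem_iUnion.2 ⟨γ s, hxU (γ s)⟩)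
    have key : ∀ m, PiecewiseLiftable hp (.mk (γ.subpath 0 (t m))) := by
      intro m
      induction m with
      | zero =>
        obtain ⟨d, hd⟩ := hs (γ 0)
        refine of_path _ (Path.refl d) fun s => ?_
        rw [ht0, Path.subpath_self]
        exact hd.symm
      | succ m ih =>
        obtain ⟨z, hz⟩ := htc m
        have h1 : PiecewiseLiftable hp (.mk (γ.subpath (t m) (t (m + 1)))) := by
          refine hγU z _ fun s => ?_
          have : γ.subpath (t m) (t (m + 1)) s ∈ γ '' Set.Icc (t m) (t (m + 1)) := by
            rw [← Path.range_subpath_of_le γ _ _ (htm (Nat.le_succ m))]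
            exact ⟨s, rfl⟩
          obtain ⟨u, hu, hu'⟩ := this
          rw [← hu']
          exact hz hu
        have h2 := ih.trans h1
        rw [← Path.Homotopic.Quotient.mk_trans] at h2
        rwa [Path.Homotopic.Quotient.eq.2 ⟨Path.Homotopy.subpathTransSubpath γ 0 (t m) (t (m + 1))⟩] at h2
    have h1 := key n
    rw [hn n le_rfl, Path.subpath_zero_one] at h1
    exact h1.congr γ fun _ => rfl

/-- A deformation of a saturated open set onto a discrete set of points, given upstairs, shows that
paths in it are piecewise liftable. -/
theorem of_deformation (hq : IsQuotientMap p) {V : Set D} (hV : IsOpen V)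
    (hVs : ∀ d d', p d = p d' → d ∈ V → d' ∈ V) (h : D → I → D)
    (hc : ∀ d ∈ V, ∀ t, ContinuousAt (fun x : D × I => h x.1 x.2) (d, t))
    (h0 : ∀ d ∈ V, h d 0 = d)
    (hcompat : ∀ d d', p d = p d' → d ∈ V → ∀ t, p (h d t) = p (h d' t))
    (h1 : ∀ d ∈ V, ∀ᶠ d' in 𝓝 d, h d' 1 = h d 1) :
    IsOpen (p '' V) ∧ ∀ {a b : X} (γ : Path a b), (∀ t, γ t ∈ p '' V) →
      PiecewiseLiftable hq.continuous (.mk γ) := by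
  have hpre : p ⁻¹' (p '' V) = V := by
    ext d
    constructor
    · rintro ⟨d', hd', he⟩
      exact hVs d' d he hd'
    · exact fun hd => ⟨d, hd, rfl⟩
  have hmem : ∀ d : p ⁻¹' (p '' V), (d : D) ∈ V := fun d => hpre.subset d.2
  have hU : IsOpen (p '' V) := by
    rw [← hq.isOpen_preimage, hpre]
    exact hV
  refine ⟨hU, fun {a b} γ hγ => ?_⟩
  have hqU : IsQuotientMap ((p '' V).restrictPreimage p) := hq.restrictPreimage_isOpen hU
  -- Currying in time lets the deformation descend along `p` alone; the product of `p` with the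
  -- interval need not be shown to be a quotient map.
  let h' : C(p ⁻¹' (p '' V), C(I, X)) := ContinuousMap.curry
    ⟨fun x => p (h x.1 x.2), hq.continuous.comp <| continuous_iff_continuousAt.2 fun x => by
      have hx : (x.1 : D) ∈ V := hmem x.1
      exact ContinuousAt.comp (g := fun x : D × I => h x.1 x.2)
        (f := fun x : p ⁻¹' (p '' V) × I => ((x.1 : D), x.2)) (hc x.1 hx x.2) (by fun_prop)⟩
  choose s hs hs' using fun x : p '' V => x.2
  let H : p '' V → C(I, X) := fun x => h' ⟨s x, ⟨s x, hs x, rfl⟩⟩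
  have hH : H ∘ (p '' V).restrictPreimage p = h' := by
    ext d t
    have hd : (d : D) ∈ V := hmem d
    exact hcompat _ _ (hs' ((p '' V).restrictPreimage p d)) (hs _) t
  have hHc : Continuous H := hqU.continuous_iff.2 (by rw [hH]; exact h'.continuous)
  let u : I → p '' V := fun t => ⟨γ t, hγ t⟩
  have hu : Continuous u := by fun_prop
  let K : I × I → X := fun x => H (u x.2) x.1
  have hK : Continuous K := by
    have : Continuous fun x : I × I => (H (u x.2), x.1) := by fun_prop
    exact continuous_eval.comp this
  have hKs : ∀ x t, H x t = p (h (s x) t) := fun x t => rfl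
  -- The end of the deformation is locally constant downstairs, and the path parameter runs over a
  -- connected interval.
  have hK1 : ∀ t, K (1, t) = K (1, 0) := by
    have hloc : IsLocallyConstant fun x : p '' V => H x 1 := by
      have hl : IsLocallyConstant (fun d : p ⁻¹' (p '' V) => h' d 1) := by
        rw [IsLocallyConstant.iff_eventually_eq]
        intro d
        have hd : (d : D) ∈ V := hmem d
        have := (continuous_subtype_val.tendsto d).eventually (h1 d hd)
        filter_upwards [this] with d' hd'
        exact congrArg p hd'
      intro S
      rw [← hqU.isOpen_preimage, ← Set.preimage_comp]
      have := hl S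
      rw [← hH] at this
      exact this
    have hl2 : IsLocallyConstant fun t : I => K (1, t) := hloc.comp_continuous hu
    intro t
    exact hl2.apply_eq_of_isPreconnected isPreconnected_univ trivial trivial
  have hpath : ∀ x : p '' V, ∃ δ : Path (s x) (h (s x) 1), ∀ t, δ t = h (s x) t := fun x =>
    ⟨⟨⟨h (s x), continuous_iff_continuousAt.2 fun t =>
      ContinuousAt.comp (g := fun x : D × I => h x.1 x.2) (f := fun t => (s x, t))
        (hc (s x) (hs x) t) (by fun_prop)⟩, h0 _ (hs x), rfl⟩, fun t => rfl⟩
  obtain ⟨δ₀, hδ₀⟩ := hpath (u 0)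
  obtain ⟨δ₁, hδ₁⟩ := hpath (u 1)
  have e0 : p (s (u 0)) = a := by rw [hs']; exact γ.source
  have e1 : p (s (u 1)) = b := by rw [hs']; exact γ.target
  have e2 : p (h (s (u 1)) 1) = p (h (s (u 0)) 1) := hK1 1
  let r : Path b (p (h (s (u 0)) 1)) := (δ₁.map hq.continuous).cast e1.symm e2.symm
  let l : Path a (p (h (s (u 0)) 1)) := (δ₀.map hq.continuous).cast e0.symm rfl
  have hsq := Path.Homotopic.of_square K hK γ r l (Path.refl _)
    (fun t => by
      change (γ t) = H (u t) 0
      rw [hKs, h0 _ (hs _), hs'])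
    (fun t => by
      change p (δ₁ t) = _
      rw [hδ₁]
      rfl)
    (fun t => by
      change p (δ₀ t) = _
      rw [hδ₀]
      rfl)
    (fun t => (hK1 t).symm)
  -- One edge of the square is constant, so `γ` is homotopic to the track of its start followed by
  -- the reversed track of its end, and both tracks lift.
  have hγ' : Path.Homotopic.Quotient.mk γ = ((Path.Homotopic.Quotient.mk l).trans
      (Path.Homotopic.Quotient.mk r.symm)) := by
    have h2 := Path.Homotopic.Quotient.eq.2 hsq
    rw [Path.Homotopic.Quotient.mk_trans, Path.Homotopic.Quotient.mk_trans,
      Path.Homotopic.Quotient.mk_refl, Path.Homotopic.Quotient.trans_refl] at h2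
    rw [← h2, Path.Homotopic.Quotient.trans_assoc, Path.Homotopic.Quotient.mk_symm,
      Path.Homotopic.Quotient.trans_symm, Path.Homotopic.Quotient.trans_refl]
  rw [hγ']
  exact (of_path l δ₀ fun t => rfl).trans (of_path r.symm δ₁.symm fun t => rfl)

end PiecewiseLiftable

end Liftable

/-! ### Flat bundles as covering spaces -/

section FlatBundle

variable {D X G ι : Type*} [TopologicalSpace D] [TopologicalSpace X] [Group G] {p : D → X}

/-- The flat bundle on a quotient `X` of `D`, trivialized on `D`, that is given by locally
constant frames `f j` on saturated open subsets `V j` of `D`. -/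
@[simps baseSet indexAt coordChange]
noncomputable def flatBundleCore [TopologicalSpace G] (hq : IsQuotientMap p) (V : ι → Set D)
    (hV : ∀ j, IsOpen (V j)) (hVs : ∀ j d d', p d = p d' → d ∈ V j → d' ∈ V j) (i : X → ι)
    (hi : ∀ d, d ∈ V (i (p d))) (f : ι → D → G)
    (hf : ∀ j, ∀ d ∈ V j, ∀ᶠ d' in 𝓝 d, f j d' = f j d)
    (hcompat : ∀ j k d d', p d = p d' → d ∈ V j → d ∈ V k →
      f k d * (f j d)⁻¹ = f k d' * (f j d')⁻¹) [ContinuousMul G] : FiberBundleCore ι X G where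
  baseSet j := p '' V j
  isOpen_baseSet j := by
    rw [← hq.isOpen_preimage]
    convert hV j
    ext d
    exact ⟨fun ⟨d', hd', he⟩ => hVs j d' d he hd', fun hd => ⟨d, hd, rfl⟩⟩
  indexAt := i
  mem_baseSet_at x := by
    obtain ⟨d, rfl⟩ := hq.surjective x
    exact ⟨d, hi d, rfl⟩
  -- By `hcompat` any point above `x` in both sets gives the same transition, so the choice made by
  -- `surjInv` does not matter.
  coordChange j k x v := f k (Function.surjInv hq.surjective x) *
    (f j (Function.surjInv hq.surjective x))⁻¹ * v
  coordChange_self j x _ v := by simp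
  continuousOn_coordChange j k := by
    rintro ⟨x, v⟩ ⟨⟨⟨d, hd, hdx⟩, ⟨d', hd', hdx'⟩⟩, -⟩
    replace hd' : d ∈ V k := hVs k d' d (hdx'.trans hdx.symm) hd'
    clear hdx' d'
    dsimp only at hdx
    subst hdx
    refine ContinuousAt.continuousWithinAt ?_
    have h1 : IsOpen (p '' {d' | (d' ∈ V j ∧ d' ∈ V k) ∧
        f k d' * (f j d')⁻¹ = f k d * (f j d)⁻¹}) := by
      rw [← hq.isOpen_preimage]
      rw [isOpen_iff_mem_nhds]
      rintro a ⟨b, ⟨⟨hb, hb'⟩, hb''⟩, he⟩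
      have ha := hVs j b a he hb
      have ha' := hVs k b a he hb'
      filter_upwards [(hV j).mem_nhds ha, (hV k).mem_nhds ha', hf j a ha, hf k a ha']
        with e he1 he2 he3 he4
      refine ⟨e, ⟨⟨he1, he2⟩, ?_⟩, rfl⟩
      rw [he3, he4, ← hb'']
      exact (hcompat j k b a he hb hb').symm
    have h2 : ∀ᶠ y in 𝓝 (p d, v), f k (Function.surjInv hq.surjective y.1) *
        (f j (Function.surjInv hq.surjective y.1))⁻¹ * y.2 = f k d * (f j d)⁻¹ * y.2 := by
      have := (continuous_fst.tendsto (p d, v)).eventually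
        (h1.mem_nhds ⟨d, ⟨⟨hd, hd'⟩, rfl⟩, rfl⟩)
      filter_upwards [this] with y hy
      obtain ⟨e, ⟨⟨he1, he2⟩, he3⟩, he4⟩ := hy
      rw [← he3, hcompat j k e (Function.surjInv hq.surjective y.1) _ he1 he2]
      rw [he4, Function.surjInv_eq hq.surjective]
    refine ContinuousAt.congr ?_ (EventuallyEq.symm h2)
    fun_prop
  coordChange_comp j k l x _ v := by group

variable (hq : IsQuotientMap p) (V : ι → Set D)
    (hV : ∀ j, IsOpen (V j)) (hVs : ∀ j d d', p d = p d' → d ∈ V j → d' ∈ V j) (i : X → ι)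
    (hi : ∀ d, d ∈ V (i (p d))) (f : ι → D → G)
    (hf : ∀ j, ∀ d ∈ V j, ∀ᶠ d' in 𝓝 d, f j d' = f j d)
    (hcompat : ∀ j k d d', p d = p d' → d ∈ V j → d ∈ V k →
      f k d * (f j d)⁻¹ = f k d' * (f j d')⁻¹)

include hV hVs hi hf hcompat in
/-- The holonomy of the flat bundle given by locally constant frames. -/
theorem exists_pathHom_of_frames
    (hgen : ∀ {x y : X} (q : Path.Homotopic.Quotient x y), PiecewiseLiftable hq.continuous q) :
    ∃ F : PathHom X G, ∀ {d d' : D} (δ : Path d d'),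
      F.onPath (δ.map hq.continuous) = f (i (p d')) d' * (f (i (p d)) d)⁻¹ := by
  -- With discrete fibre the bundle is a covering, and its monodromy supplies homotopy invariance.
  let _ : TopologicalSpace G := ⊥
  have : DiscreteTopology G := ⟨rfl⟩
  let Z := flatBundleCore hq V hV hVs i hi f hf hcompat
  have cov : IsCoveringMap (Bundle.TotalSpace.proj : Z.TotalSpace → X) :=
    FiberBundle.isCoveringMap
  have hmap : ∀ {d d' : D} (δ : Path d d') (g : G),
      (cov.monodromy (.mk (δ.map hq.continuous)) ⟨⟨p d, (g : G)⟩, rfl⟩).1 =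
        ⟨p d', (f (i (p d')) d' * (f (i (p d)) d)⁻¹ * g : G)⟩ := by
    intro d d' δ g
    -- A constant section of the trivialization over `D`, rewritten in the local frames.
    let u : I → Z.TotalSpace := fun t =>
      ⟨p (δ t), (f (i (p (δ t))) (δ t) * (f (i (p d)) d)⁻¹ * g : G)⟩
    have hu : Continuous u := by
      rw [continuous_iff_continuousAt]
      intro t
      rw [FiberBundle.continuousAt_totalSpace]
      refine ⟨(hq.continuous.comp δ.continuous).continuousAt, ?_⟩
      have h1 := (δ.continuous.tendsto t).eventually (hf (i (p (δ t))) (δ t) (hi _))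
      have h2 : (fun s => ((trivializationAt G Z.Fiber (u t).proj) (u s)).2) =ᶠ[𝓝 t]
          fun _ => f (i (p (δ t))) (δ t) * (f (i (p d)) d)⁻¹ * g := by
        filter_upwards [h1, (δ.continuous.tendsto t).eventually ((hV _).mem_nhds (hi (δ t)))]
          with s hs hs'
        change f (i (p (δ t))) (Function.surjInv hq.surjective (p (δ s))) *
          (f (i (p (δ s))) (Function.surjInv hq.surjective (p (δ s))))⁻¹ *
            (f (i (p (δ s))) (δ s) * (f (i (p d)) d)⁻¹ * g) = _
        rw [← hcompat _ _ (δ s) _ (Function.surjInv_eq hq.surjective _).symm (hi _) hs', hs]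
        group
      exact ContinuousAt.congr continuousAt_const h2.symm
    let Γ : Path (⟨p d, (g : G)⟩ : Z.TotalSpace)
        ⟨p d', (f (i (p d')) d' * (f (i (p d)) d)⁻¹ * g : G)⟩ :=
      { toFun := u
        continuous_toFun := hu
        source' := by
          change (⟨p (δ 0), (f (i (p (δ 0))) (δ 0) * (f (i (p d)) d)⁻¹ * g : G)⟩ :
            Z.TotalSpace) = _
          rw [δ.source, mul_inv_cancel, one_mul]
        target' := by
          change (⟨p (δ 1), (f (i (p (δ 1))) (δ 1) * (f (i (p d)) d)⁻¹ * g : G)⟩ :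
            Z.TotalSpace) = _
          rw [δ.target] }
    exact congrArg Subtype.val (cov.monodromy_map (.mk Γ))
  -- Monodromy is left multiplication by an element of `G`: this holds on images of paths of `D` and
  -- survives concatenation.
  have hex : ∀ {x y : X} (q : Path.Homotopic.Quotient x y), ∃ c : G, ∀ g : G,
      (cov.monodromy q ⟨⟨x, (g : G)⟩, rfl⟩).1 = (⟨y, (c * g : G)⟩ : Z.TotalSpace) := by
    intro x y q
    induction hgen q with
    | map δ => exact ⟨_, hmap δ⟩
    | @trans x y z q q' _ _ ih ih' =>
      obtain ⟨c, hc⟩ := ih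
      obtain ⟨c', hc'⟩ := ih'
      refine ⟨c' * c, fun g => ?_⟩
      rw [cov.monodromy_trans_apply,
        show cov.monodromy q ⟨⟨x, (g : G)⟩, rfl⟩ = ⟨⟨y, (c * g : G)⟩, rfl⟩ from Subtype.ext (hc g),
        hc', mul_assoc]
  have huniq : ∀ {y : X} {c c' : G}, (⟨y, (c : G)⟩ : Z.TotalSpace) = ⟨y, (c' : G)⟩ → c = c' := by
    intro y c c' h
    exact Bundle.TotalSpace.mk_injective y h
  choose c hc using @hex
  refine ⟨⟨fun q => c q, fun {x y z} q q' => ?_⟩, fun {d d'} δ => ?_⟩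
  · have h1 := hc (q.trans q') 1
    rw [cov.monodromy_trans_apply, show cov.monodromy q ⟨⟨x, (1 : G)⟩, rfl⟩ =
      ⟨⟨y, (c q * 1 : G)⟩, rfl⟩ from Subtype.ext (hc q 1), hc q'] at h1
    simpa using (huniq h1).symm
  · have h1 := hc (.mk (δ.map hq.continuous)) 1
    rw [hmap δ 1] at h1
    change c _ = _
    simpa using (huniq h1).symm

end FlatBundle

namespace Surface

/-! ### Polar coordinates -/

/-- The point of the unit circle at the angle `θ`, where the full turn is `n`. -/
noncomputable def circ (n : ℕ) (θ : ℝ) : ℂ := Complex.exp ((2 * Real.pi * (θ / n) : ℝ) * Complex.I)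

theorem norm_circ (n : ℕ) (θ : ℝ) : ‖circ n θ‖ = 1 := Complex.norm_exp_ofReal_mul_I _

theorem circ_ne_zero (n : ℕ) (θ : ℝ) : circ n θ ≠ 0 := Complex.exp_ne_zero _

theorem circ_zero (n : ℕ) : circ n 0 = 1 := by simp [circ]

theorem circ_add (n : ℕ) (a b : ℝ) : circ n (a + b) = circ n a * circ n b := by
  rw [circ, circ, circ, ← Complex.exp_add]
  congr 1
  push_cast
  ring

theorem circ_eq_circ_iff {n : ℕ} (hn : n ≠ 0) {a b : ℝ} :
    circ n a = circ n b ↔ ∃ m : ℤ, a = b + n * m := by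
  have hn' : (n : ℝ) ≠ 0 := Nat.cast_ne_zero.2 hn
  have hpi := Real.pi_ne_zero
  rw [circ, circ, Complex.exp_eq_exp_iff_exists_int]
  refine exists_congr fun m => ?_
  have : ((2 * Real.pi * (b / n) : ℝ) : ℂ) * Complex.I + m * (2 * Real.pi * Complex.I) =
      ((2 * Real.pi * (b / n) + m * (2 * Real.pi) : ℝ) : ℂ) * Complex.I := by
    push_cast
    ring
  rw [this, mul_left_inj' Complex.I_ne_zero, Complex.ofReal_inj]
  constructor
  · intro h
    field_simp at h
    linarith
  · rintro rfl
    field_simp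

theorem circ_add_mul {n : ℕ} (hn : n ≠ 0) (a : ℝ) (m : ℤ) : circ n (a + n * m) = circ n a :=
  (circ_eq_circ_iff hn).2 ⟨m, rfl⟩

/-- The angle of a point, where the full turn is `n`. -/
noncomputable def angle (n : ℕ) (z : ℂ) : ℝ := n * Complex.arg z / (2 * Real.pi)

theorem norm_mul_circ_angle {n : ℕ} (hn : n ≠ 0) (z : ℂ) : ‖z‖ * circ n (angle n z) = z := by
  have hn' : (n : ℝ) ≠ 0 := Nat.cast_ne_zero.2 hn
  have hpi := Real.pi_ne_zero
  have : 2 * Real.pi * (angle n z / n) = Complex.arg z := by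
    rw [angle]
    field_simp
  rw [circ, this, Complex.norm_mul_exp_arg_mul_I]

theorem exists_angle_eq {n : ℕ} (hn : n ≠ 0) {ρ : ℝ} (hρ : 0 < ρ) (θ : ℝ) :
    ∃ m : ℤ, angle n (ρ * circ n θ) = θ + n * m := by
  rw [← circ_eq_circ_iff hn]
  have h := norm_mul_circ_angle hn (ρ * circ n θ)
  rw [norm_mul, norm_circ, mul_one, Complex.norm_real, Real.norm_of_nonneg hρ.le] at h
  exact mul_left_cancel₀ (Complex.ofReal_ne_zero.2 hρ.ne') h

theorem arg_mul_circ {n : ℕ} (hn : n ≠ 0) {ρ : ℝ} (hρ : 0 < ρ) {τ : ℝ}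
    (h1 : -(n / 2 : ℝ) < τ) (h2 : τ ≤ n / 2) : Complex.arg (ρ * circ n τ) = 2 * Real.pi * (τ / n) := by
  have hn' : (0 : ℝ) < n := Nat.cast_pos.2 (Nat.pos_of_ne_zero hn)
  have hpi := Real.pi_pos
  have e1 : 2 * Real.pi * (τ / n) = Real.pi * (2 * τ / n) := by ring
  rw [circ, Complex.arg_real_mul _ hρ, Complex.arg_exp_mul_I, toIocMod_eq_self]
  rw [e1]
  constructor
  · have : -1 < 2 * τ / n := by
      rw [lt_div_iff₀ hn']
      linarith
    nlinarith
  · have : 2 * τ / n ≤ 1 := by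
      rw [div_le_iff₀ hn']
      linarith
    nlinarith

/-! ### Sectors and their contractions -/

/-- The union of the open sectors of width `1` that are bounded by the rays at the angles `s + m`,
`m ∈ ℤ`. -/
def InSector (n : ℕ) (s : ℝ) (z : ℂ) : Prop := z ≠ 0 ∧ ∀ m : ℤ, angle n z - s ≠ m

/-- The index of the sector that contains `z`. -/
noncomputable def sectorIndex (n : ℕ) (s : ℝ) (z : ℂ) : ℤ := ⌊angle n z - s⌋

/-- The contraction of a sector with central angle `c` to the point of the circle at the
angle `c`. -/
noncomputable def contractTo (n : ℕ) (c : ℝ) (z : ℂ) (t : ℝ) : ℂ :=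
  circ n c * (z * circ n (-c)) ^ ((1 - t : ℝ) : ℂ)

theorem contractTo_add_mul {n : ℕ} (hn : n ≠ 0) (c : ℝ) (m : ℤ) :
    contractTo n (c + n * m) = contractTo n c := by
  funext z t
  have : -(c + n * m) = -c + n * (-m : ℤ) := by push_cast; ring
  rw [contractTo, contractTo, this, circ_add_mul hn, circ_add_mul hn]

/-- Since `angle` is a principal value, polar coordinates fix the sector index only modulo `n`. -/
theorem inSector_polar {n : ℕ} (hn : n ≠ 0) {s ρ θ : ℝ} (hρ : 0 < ρ) {k : ℤ}
    (h1 : k < θ - s) (h2 : θ - s < k + 1) :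
    InSector n s (ρ * circ n θ) ∧ ∃ m : ℤ, sectorIndex n s (ρ * circ n θ) = k + n * m := by
  obtain ⟨m, hm⟩ := exists_angle_eq hn hρ θ
  refine ⟨⟨mul_ne_zero (Complex.ofReal_ne_zero.2 hρ.ne') (circ_ne_zero n θ), fun l hl => ?_⟩,
    m, ?_⟩
  · rw [hm] at hl
    have e1 : ((k + n * m : ℤ) : ℝ) < l := by
      rw [← hl]
      push_cast
      linarith
    have e2 : (l : ℝ) < ((k + n * m + 1 : ℤ) : ℝ) := by
      rw [← hl]
      push_cast
      linarith
    have e1' := Int.cast_lt.1 e1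
    have e2' := Int.cast_lt.1 e2
    omega
  · rw [sectorIndex, hm, Int.floor_eq_iff]
    push_cast
    constructor <;> linarith

theorem ne_int_of_inSector {n : ℕ} (hn : n ≠ 0) {s ρ θ : ℝ} (hρ : 0 < ρ)
    (h : InSector n s (ρ * circ n θ)) (k : ℤ) : θ - s ≠ k := by
  obtain ⟨m, hm⟩ := exists_angle_eq hn hρ θ
  intro hk
  refine h.2 (k + n * m) ?_
  rw [hm]
  push_cast
  linarith

theorem inSector_polar_iff {n : ℕ} (hn : n ≠ 0) {s ρ θ : ℝ} (hρ : 0 < ρ) :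
    InSector n s (ρ * circ n θ) ↔ ∀ k : ℤ, θ - s ≠ k := by
  refine ⟨ne_int_of_inSector hn hρ, fun h => ?_⟩
  refine (inSector_polar hn hρ (k := ⌊θ - s⌋) ?_ (Int.lt_floor_add_one _)).1
  exact lt_of_le_of_ne (Int.floor_le _) (h _).symm

/-- For `n ≥ 2` the sector, rotated to be centred on the positive axis, lies in the right
half-plane. There the principal power acts separately on radius and angle, so the unit circle is
preserved. -/
theorem contractTo_polar {n : ℕ} (hn : 2 ≤ n) {ρ θ c : ℝ} (hρ : 0 < ρ)
    (h1 : c - 1 / 2 < θ) (h2 : θ < c + 1 / 2) (t : ℝ) :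
    contractTo n c (ρ * circ n θ) t = ((ρ ^ (1 - t) : ℝ) : ℂ) * circ n (c + (1 - t) * (θ - c)) := by
  have hn0 : n ≠ 0 := by omega
  have hn2 : (2 : ℝ) ≤ n := by exact_mod_cast hn
  have e1 : (ρ : ℂ) * circ n θ * circ n (-c) = ρ * circ n (θ - c) := by
    rw [mul_assoc, ← circ_add, sub_eq_add_neg]
  have harg := arg_mul_circ hn0 hρ (τ := θ - c) (by linarith) (by linarith)
  have hne : (ρ : ℂ) * circ n (θ - c) ≠ 0 :=
    mul_ne_zero (Complex.ofReal_ne_zero.2 hρ.ne') (circ_ne_zero n _)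
  rw [contractTo, e1, Complex.cpow_def_of_ne_zero hne, Complex.log, harg, norm_mul, norm_circ,
    mul_one, Complex.norm_real, Real.norm_of_nonneg hρ.le, circ_add, Real.rpow_def_of_pos hρ,
    Complex.ofReal_exp, circ, circ, ← Complex.exp_add, ← Complex.exp_add, ← Complex.exp_add]
  congr 1
  push_cast
  ring

theorem mem_slitPlane_of_sector {n : ℕ} (hn : 2 ≤ n) {ρ θ c : ℝ} (hρ : 0 < ρ)
    (h1 : c - 1 / 2 < θ) (h2 : θ < c + 1 / 2) :
    (ρ : ℂ) * circ n θ * circ n (-c) ∈ Complex.slitPlane := by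
  have hn0 : n ≠ 0 := by omega
  have hn2 : (2 : ℝ) ≤ n := by exact_mod_cast hn
  have e1 : (ρ : ℂ) * circ n θ * circ n (-c) = ρ * circ n (θ - c) := by
    rw [mul_assoc, ← circ_add, sub_eq_add_neg]
  have hpi := Real.pi_pos
  rw [e1, Complex.mem_slitPlane_iff_arg, arg_mul_circ hn0 hρ (by linarith) (by linarith)]
  refine ⟨fun h => ?_, mul_ne_zero (Complex.ofReal_ne_zero.2 hρ.ne') (circ_ne_zero n _)⟩
  have h3 : 2 * ((θ - c) / n) = 1 := by
    have : Real.pi * (2 * ((θ - c) / n)) = Real.pi * 1 := by rw [mul_one]; linarith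
    exact mul_left_cancel₀ hpi.ne' this
  have : (θ - c) / n < 1 / 2 := by
    rw [div_lt_iff₀ (by linarith)]
    linarith
  linarith

theorem sector_bounds {n : ℕ} {s : ℝ} {z : ℂ} (h : InSector n s z) :
    (sectorIndex n s z : ℝ) < angle n z - s ∧ angle n z - s < sectorIndex n s z + 1 :=
  ⟨lt_of_le_of_ne (Int.floor_le _) (h.2 _).symm, Int.lt_floor_add_one _⟩

/-- `angle` jumps across the negative axis, but the angle of `w / z` is continuous at `w = z`.
Adding it to the angle of `z` gives a continuous angle of `w`, correct modulo `n`. -/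
theorem eventually_inSector {n : ℕ} (hn : n ≠ 0) {s : ℝ} {z : ℂ} (h : InSector n s z) :
    ∀ᶠ w in 𝓝 z, InSector n s w ∧ ∃ m : ℤ, sectorIndex n s w = sectorIndex n s z + n * m := by
  have hz := h.1
  obtain ⟨h1, h2⟩ := sector_bounds h
  have hA : ContinuousAt (fun w => angle n z + angle n (w / z) - s) z := by
    unfold angle
    have : ContinuousAt (fun w => Complex.arg (w / z)) z := by
      refine ContinuousAt.comp (g := Complex.arg) (Complex.continuousAt_arg ?_) (by fun_prop)
      rw [div_self hz]
      exact Complex.one_mem_slitPlane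
    fun_prop
  have hA0 : angle n z + angle n (z / z) - s = angle n z - s := by
    rw [div_self hz]
    simp [angle]
  have e1 := hA.eventually_const_lt (u := (sectorIndex n s z : ℝ)) (by dsimp only; rwa [hA0])
  have e2 := hA.eventually_lt_const (u := (sectorIndex n s z + 1 : ℝ)) (by dsimp only; rwa [hA0])
  filter_upwards [e1, e2, isOpen_ne.mem_nhds hz] with w hw1 hw2 hw
  have hw' : ((‖w‖ : ℝ) : ℂ) * circ n (angle n z + angle n (w / z)) = w := by
    have e3 := norm_mul_circ_angle hn z
    have e4 := norm_mul_circ_angle hn (w / z)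
    have e5 : (‖w‖ : ℂ) = ‖z‖ * ‖w / z‖ := by
      rw [norm_div]
      push_cast
      rw [mul_div_cancel₀ _ (by simpa using hz)]
    rw [circ_add, e5]
    calc _ = ((‖z‖ : ℂ) * circ n (angle n z)) * (‖w / z‖ * circ n (angle n (w / z))) := by ring
      _ = w := by rw [e3, e4, mul_div_cancel₀ _ hz]
  have := inSector_polar hn (norm_pos_iff.2 hw) hw1 hw2
  rwa [hw'] at this

/-- The contraction of the sectors to the middle points of their arcs. -/
noncomputable def contract (n : ℕ) (s : ℝ) (z : ℂ) (t : ℝ) : ℂ :=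
  contractTo n (sectorIndex n s z + s + 1 / 2) z t

theorem contract_eq_of_index {n : ℕ} (hn : n ≠ 0) {s : ℝ} {z : ℂ} {k m : ℤ}
    (h : sectorIndex n s z = k + n * m) : contract n s z = contractTo n (k + s + 1 / 2) z := by
  funext t
  have : ((k + n * m : ℤ) : ℝ) + s + 1 / 2 = (k + s + 1 / 2) + n * m := by
    push_cast
    ring
  rw [contract, h, this, contractTo_add_mul hn]

theorem contract_polar {n : ℕ} (hn : 2 ≤ n) {s ρ θ : ℝ} (hρ : 0 < ρ) {k : ℤ}
    (h1 : k < θ - s) (h2 : θ - s < k + 1) (t : ℝ) :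
    contract n s (ρ * circ n θ) t = ((ρ ^ (1 - t) : ℝ) : ℂ) *
      circ n ((k + s + 1 / 2) + (1 - t) * (θ - (k + s + 1 / 2))) := by
  have hn0 : n ≠ 0 := by omega
  obtain ⟨-, m, hm⟩ := inSector_polar hn0 hρ h1 h2
  rw [contract_eq_of_index hn0 hm, contractTo_polar hn hρ (by linarith) (by linarith)]

theorem contract_zero (n : ℕ) (s : ℝ) (z : ℂ) : contract n s z 0 = z := by
  rw [contract, contractTo, sub_zero, Complex.ofReal_one, Complex.cpow_one, mul_left_comm,
    ← circ_add, add_neg_cancel, circ_zero, mul_one]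

theorem contract_one (n : ℕ) (s : ℝ) (z : ℂ) :
    contract n s z 1 = circ n (sectorIndex n s z + s + 1 / 2) := by
  rw [contract, contractTo, sub_self, Complex.ofReal_zero, Complex.cpow_zero, mul_one]

theorem norm_contract_le {n : ℕ} {s : ℝ} {z : ℂ} (hz : ‖z‖ ≤ 1) {t : ℝ} (ht : t ≤ 1) :
    ‖contract n s z t‖ ≤ 1 := by
  rw [contract, contractTo, norm_mul, norm_circ, one_mul, Complex.norm_cpow_real, norm_mul,
    norm_circ, mul_one]
  exact Real.rpow_le_one (norm_nonneg _) hz (by linarith)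

theorem continuousAt_contract {n : ℕ} (hn : 2 ≤ n) {s : ℝ} {z : ℂ} (h : InSector n s z) (t : ℝ) :
    ContinuousAt (fun x : ℂ × ℝ => contract n s x.1 x.2) (z, t) := by
  have hn0 : n ≠ 0 := by omega
  obtain ⟨h1, h2⟩ := sector_bounds h
  have hev : (fun x : ℂ × ℝ => contract n s x.1 x.2) =ᶠ[𝓝 (z, t)]
      fun x => contractTo n (sectorIndex n s z + s + 1 / 2) x.1 x.2 := by
    have := (continuous_fst.tendsto (z, t)).eventually (eventually_inSector hn0 h)
    filter_upwards [this] with x hx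
    obtain ⟨-, m, hm⟩ := hx
    rw [contract_eq_of_index hn0 hm]
  refine ContinuousAt.congr ?_ hev.symm
  unfold contractTo
  refine ContinuousAt.mul continuousAt_const (ContinuousAt.cpow (by fun_prop) (by fun_prop) ?_)
  have := mem_slitPlane_of_sector hn (norm_pos_iff.2 h.1)
    (θ := angle n z) (c := sectorIndex n s z + s + 1 / 2) (by linarith) (by linarith)
  rwa [norm_mul_circ_angle hn0] at this

theorem eventually_contract_one {n : ℕ} (hn : n ≠ 0) {s : ℝ} {z : ℂ} (h : InSector n s z) :
    ∀ᶠ w in 𝓝 z, contract n s w 1 = contract n s z 1 := by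
  filter_upwards [eventually_inSector hn h] with w hw
  obtain ⟨-, m, hm⟩ := hw
  have : ((sectorIndex n s z + n * m : ℤ) : ℝ) + s + 1 / 2 =
      (sectorIndex n s z + s + 1 / 2) + n * m := by
    push_cast
    ring
  rw [contract_one, contract_one, hm, this, circ_add_mul hn]

end Surface

namespace Surface

variable {g r : ℕ}

/-! ### Charts of the surface -/

/-- The pairs of sides that are glued. -/
inductive Paired (g r : ℕ) : ℕ → ℕ → Prop
  | s : Paired g r 0 1
  | a (i : Fin g) : Paired g r (2 + 4 * i) (2 + 4 * i + 2)
  | b (i : Fin g) : Paired g r (2 + 4 * i + 1) (2 + 4 * i + 3)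
  | c (j : Fin r) : Paired g r (2 + 4 * g + 3 * j) (2 + 4 * g + 3 * j + 2)

theorem Paired.lt {k k' : ℕ} (h : Paired g r k k') : k < numSides g r ∧ k' < numSides g r := by
  unfold numSides
  cases h with
  | s => omega
  | a i => omega
  | b i => omega
  | c j => omega

theorem two_le_numSides (g r : ℕ) : 2 ≤ numSides g r := by
  unfold numSides
  omega

theorem numSides_ne_zero (g r : ℕ) : numSides g r ≠ 0 := by
  unfold numSides
  omega

theorem proj_side_eq {k k' : ℕ} (h : Paired g r k k') (t : I) :
    proj g r (side g r k t) = proj g r (side g r k' (σ t)) := by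
  cases h with
  | s => exact Quot.sound (Glue.s t)
  | a i => exact Quot.sound (Glue.a i t)
  | b i => exact Quot.sound (Glue.b i t)
  | c j => exact Quot.sound (Glue.c j t)

/-- A function that respects the gluing of the sides is constant on the fibres of `proj`. -/
theorem eq_of_proj_eq {β : Sort*} (P : Disc → β)
    (h : ∀ k k' t, Paired g r k k' → P (side g r k t) = P (side g r k' (σ t))) {d d' : Disc}
    (hd : proj g r d = proj g r d') : P d = P d' := by
  have hP : ∀ a b, Glue g r a b → P a = P b := by
    intro a b hab
    cases hab with
    | s t => exact h _ _ t Paired.s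
    | a i t => exact h _ _ t (Paired.a i)
    | b i t => exact h _ _ t (Paired.b i)
    | c j t => exact h _ _ t (Paired.c j)
  exact congrArg (Quot.lift P hP) hd

theorem coe_side (k : ℕ) (t : I) :
    (side g r k t : ℂ) = ((1 : ℝ) : ℂ) * circ (numSides g r) (k + t) := by
  rw [Complex.ofReal_one, one_mul]
  rfl

theorem norm_side (k : ℕ) (t : I) : ‖(side g r k t : ℂ)‖ = 1 := by
  rw [coe_side, norm_mul, norm_circ]
  simp

/-- The sectors are centred at the vertices for `false` and at the sides for `true`. -/
noncomputable def shift (b : Bool) : ℝ := if b then 0 else -1 / 2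

/-- The charts of the surface, given as saturated open sets of the disc: the interior of the disc,
the neighbourhood of the vertices, and the neighbourhood of the sides. -/
def chart (g r : ℕ) : Option Bool → Set Disc
  | none => {d | ‖(d : ℂ)‖ < 1}
  | some b => {d | InSector (numSides g r) (shift b) d}

theorem isOpen_chart (g r : ℕ) (o : Option Bool) : IsOpen (chart g r o) := by
  cases o with
  | none => exact isOpen_lt (by fun_prop) continuous_const
  | some b =>
    rw [isOpen_iff_mem_nhds]
    intro d hd
    have := (continuous_subtype_val.tendsto d).eventually
      (eventually_inSector (numSides_ne_zero g r) hd)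
    filter_upwards [this] with d' hd'
    exact hd'.1

theorem exists_two_mul_shift (b : Bool) : ∃ e : ℤ, 2 * shift b = -e := by
  cases b
  · exact ⟨1, by norm_num [shift]⟩
  · exact ⟨0, by norm_num [shift]⟩

theorem side_mem_chart_iff {b : Bool} {k : ℕ} {t : I} :
    side g r k t ∈ chart g r (some b) ↔ ∀ m : ℤ, (t : ℝ) - shift b ≠ m := by
  change InSector _ _ _ ↔ _
  rw [coe_side, inSector_polar_iff (numSides_ne_zero g r) one_pos]
  constructor
  · intro h m hm
    exact h (k + m) (by push_cast; linarith)
  · intro h m hm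
    exact h (m - k) (by push_cast; linarith)

/-- Gluing reflects a side about its midpoint, and the excluded parameters (integers for `true`,
half-integers for `false`) are symmetric under `t ↦ 1 - t`. -/
theorem side_symm_mem_chart_iff {b : Bool} {k k' : ℕ} {t : I} :
    side g r k (σ t) ∈ chart g r (some b) ↔ side g r k' t ∈ chart g r (some b) := by
  rw [side_mem_chart_iff, side_mem_chart_iff]
  obtain ⟨e, he⟩ := exists_two_mul_shift b
  constructor
  · intro h m hm
    refine h (1 + e - m) ?_
    rw [unitInterval.coe_symm_eq]
    push_cast
    linarith
  · intro h m hm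
    refine h (1 + e - m) ?_
    rw [unitInterval.coe_symm_eq] at hm
    push_cast
    linarith

theorem chart_saturated (o : Option Bool) {d d' : Disc} (h : proj g r d = proj g r d')
    (hd : d ∈ chart g r o) : d' ∈ chart g r o := by
  have := eq_of_proj_eq (fun d => d ∈ chart g r o) (fun k k' t hk => ?_) h
  · exact this.mp hd
  · cases o with
    | none => simp [chart, norm_side]
    | some b => exact propext side_symm_mem_chart_iff.symm

/-- Only points of the unit circle are glued: sending them to `none` and interior points to
themselves respects the gluing. -/
theorem eq_of_proj_eq_of_interior {d d' : Disc} (h : proj g r d = proj g r d')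
    (hd : d ∈ chart g r none) : d = d' := by
  classical
  have := eq_of_proj_eq (fun d => if ‖(d : ℂ)‖ < 1 then some d else none)
    (fun k k' t hk => by simp [norm_side]) h
  have hd' : ‖(d' : ℂ)‖ < 1 := chart_saturated none h hd
  have hd0 : ‖(d : ℂ)‖ < 1 := hd
  simpa [hd0, hd'] using this

/-- Away from the centre, a point missed by both sector charts would have an angle that is at once
an integer and a half-integer. -/
theorem exists_mem_chart (d : Disc) (hd : d ∉ chart g r (some false))
    (hd' : d ∉ chart g r (some true)) : d ∈ chart g r none := by
  by_contra h
  have h0 : (d : ℂ) ≠ 0 := by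
    intro h0
    exact h (by simp [chart, h0])
  have key : ∀ b : Bool, d ∉ chart g r (some b) →
      ∃ m : ℤ, angle (numSides g r) d - shift b = m := by
    intro b hb
    by_contra! hne
    exact hb ⟨h0, hne⟩
  obtain ⟨m, hm⟩ := key _ hd
  obtain ⟨m', hm'⟩ := key _ hd'
  have h2 : ((2 * m : ℤ) : ℝ) = ((2 * m' + 1 : ℤ) : ℝ) := by
    push_cast
    rw [← hm, ← hm']
    norm_num [shift]
    ring
  have := Int.cast_injective h2
  omega

/-- The deformations of the charts to discrete sets. -/
noncomputable def deform (g r : ℕ) : Option Bool → Disc → I → Disc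
  | none, d, t => ⟨((1 - t : ℝ) : ℂ) * d, by
      have hd := mem_closedBall_zero_iff.1 d.2
      rw [mem_closedBall_zero_iff, norm_mul, Complex.norm_real,
        Real.norm_of_nonneg (by linarith [t.2.2])]
      nlinarith [t.2.1, t.2.2, norm_nonneg (d : ℂ)]⟩
  | some b, d, t => ⟨contract (numSides g r) (shift b) d t, by
      rw [mem_closedBall_zero_iff]
      exact norm_contract_le (mem_closedBall_zero_iff.1 d.2) t.2.2⟩

theorem floor_side {b : Bool} {k : ℕ} {t : I} (h : side g r k t ∈ chart g r (some b)) :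
    ∃ j : ℤ, j < (t : ℝ) - shift b ∧ (t : ℝ) - shift b < j + 1 :=
  ⟨_, lt_of_le_of_ne (Int.floor_le _) (side_mem_chart_iff.1 h _).symm, Int.lt_floor_add_one _⟩

theorem deform_side_eq {b : Bool} {t : I} {j : ℤ} (h1 : j < (t : ℝ) - shift b)
    (h2 : (t : ℝ) - shift b < j + 1) (τ x : I)
    (hx : (x : ℝ) = (j + shift b + 1 / 2) + (1 - τ) * (t - (j + shift b + 1 / 2))) (k : ℕ) :
    deform g r (some b) (side g r k t) τ = side g r k x := by
  apply Subtype.ext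
  change contract _ _ _ _ = _
  rw [coe_side, contract_polar (two_le_numSides g r) one_pos (k := k + j)
    (by push_cast; linarith) (by push_cast; linarith), coe_side, Real.one_rpow, hx]
  congr 2
  push_cast
  ring

/-- The sector of a side point is centred at an end point or the midpoint of that side, so the
contraction stays on the side. Reflection carries sector `j` to sector `e - j`, so the contraction
also commutes with gluing. -/
theorem exists_deform_side {b : Bool} {k₀ : ℕ} {t : I}
    (h : side g r k₀ t ∈ chart g r (some b)) (τ : I) :
    ∃ x : I, ∀ k, deform g r (some b) (side g r k t) τ = side g r k x ∧
      deform g r (some b) (side g r k (σ t)) τ = side g r k (σ x) := by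
  obtain ⟨j, h1, h2⟩ := floor_side h
  obtain ⟨e, he⟩ := exists_two_mul_shift b
  have hc : 0 ≤ j + shift b + 1 / 2 ∧ j + shift b + 1 / 2 ≤ 1 := by
    have ht0 := t.2.1
    have ht1 := t.2.2
    cases b
    · simp only [shift, Bool.false_eq_true, if_false] at *
      have e1 : (j : ℝ) < (2 : ℤ) := by push_cast; linarith
      have e2 : ((-1 : ℤ) : ℝ) < j := by push_cast; linarith
      have e1' := Int.cast_lt.1 e1
      have e2' := Int.cast_lt.1 e2
      obtain rfl | rfl : j = 0 ∨ j = 1 := by omega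
      all_goals norm_num
    · simp only [shift, if_true] at *
      have e1 : (j : ℝ) < (1 : ℤ) := by push_cast; linarith
      have e2 : ((-1 : ℤ) : ℝ) < j := by push_cast; linarith
      have e1' := Int.cast_lt.1 e1
      have e2' := Int.cast_lt.1 e2
      obtain rfl : j = 0 := by omega
      norm_num
  let x : I := ⟨(j + shift b + 1 / 2) + (1 - τ) * (t - (j + shift b + 1 / 2)), by
    have := t.2.1
    have := t.2.2
    have := τ.2.1
    have := τ.2.2
    constructor <;> nlinarith⟩
  refine ⟨x, fun k => ⟨deform_side_eq h1 h2 τ x rfl k,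
    deform_side_eq (j := e - j) ?_ ?_ τ (σ x) ?_ k⟩⟩
  · rw [unitInterval.coe_symm_eq]
    push_cast
    linarith
  · rw [unitInterval.coe_symm_eq]
    push_cast
    linarith
  · rw [unitInterval.coe_symm_eq, unitInterval.coe_symm_eq]
    have hs : shift b = -e / 2 := by linarith
    simp only [x, hs]
    push_cast
    ring

theorem proj_deform (o : Option Bool) {d d' : Disc} (h : proj g r d = proj g r d')
    (hd : d ∈ chart g r o) (τ : I) : proj g r (deform g r o d τ) = proj g r (deform g r o d' τ) := by
  classical
  cases o with
  | none => rw [eq_of_proj_eq_of_interior h hd]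
  | some b =>
    have := eq_of_proj_eq (fun d => if d ∈ chart g r (some b) then
      some (proj g r (deform g r (some b) d τ)) else none) (fun k k' t hk => ?_) h
    · simpa [hd, chart_saturated _ h hd] using this
    · by_cases ht : side g r k t ∈ chart g r (some b)
      · have ht' : side g r k' (σ t) ∈ chart g r (some b) := side_symm_mem_chart_iff.2 ht
        obtain ⟨x, hx⟩ := exists_deform_side ht τ
        simp only [ht, ht', if_true, (hx k).1, (hx k').2, proj_side_eq hk]
      · have ht' : side g r k' (σ t) ∉ chart g r (some b) := fun h =>
          ht (side_symm_mem_chart_iff.1 h)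
        simp [ht, ht']

theorem deform_zero (o : Option Bool) (d : Disc) : deform g r o d 0 = d := by
  cases o with
  | none => simp [deform]
  | some b =>
    apply Subtype.ext
    exact contract_zero _ _ _

theorem continuousAt_deform (o : Option Bool) {d : Disc} (hd : d ∈ chart g r o) (t : I) :
    ContinuousAt (fun x : Disc × I => deform g r o x.1 x.2) (d, t) := by
  rw [Topology.IsInducing.subtypeVal.continuousAt_iff]
  cases o with
  | none =>
    refine Continuous.continuousAt ?_
    change Continuous fun x : Disc × I => ((1 - x.2 : ℝ) : ℂ) * x.1
    fun_prop
  | some b =>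
    exact ContinuousAt.comp (g := fun x : ℂ × ℝ => contract (numSides g r) (shift b) x.1 x.2)
      (f := fun x : Disc × I => ((x.1 : ℂ), (x.2 : ℝ)))
      (continuousAt_contract (two_le_numSides g r) hd _) (by fun_prop)

theorem eventually_deform_one (o : Option Bool) {d : Disc} (hd : d ∈ chart g r o) :
    ∀ᶠ d' in 𝓝 d, deform g r o d' 1 = deform g r o d 1 := by
  cases o with
  | none =>
    refine Eventually.of_forall fun d' => Subtype.ext ?_
    simp [deform]
  | some b =>
    have := (continuous_subtype_val.tendsto d).eventually
      (eventually_contract_one (numSides_ne_zero g r) hd)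
    filter_upwards [this] with d' hd'
    exact Subtype.ext hd'

variable {X : Type*} [TopologicalSpace X] (h : Standard g r ≃ₜ X)

theorem isQuotientMap_proj (g r : ℕ) : IsQuotientMap (proj g r) := isQuotientMap_quot_mk

/-- The map from the polygon to a surface that is homeomorphic to the standard one. -/
def cell (d : Disc) : X := h (proj g r d)

theorem isQuotientMap_cell : IsQuotientMap (cell h) :=
  h.isQuotientMap.comp (isQuotientMap_proj g r)

theorem cell_eq_iff {d d' : Disc} : cell h d = cell h d' ↔ proj g r d = proj g r d' :=
  h.injective.eq_iff

theorem piecewiseLiftable {x y : X} (q : Path.Homotopic.Quotient x y) :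
    PiecewiseLiftable (isQuotientMap_cell h).continuous q := by
  refine PiecewiseLiftable.of_locally (isQuotientMap_cell h).surjective (fun x => ?_) q
  obtain ⟨d, rfl⟩ := (isQuotientMap_cell h).surjective x
  have hd : ∃ o, d ∈ chart g r o := by
    by_contra! hne
    exact hne none (exists_mem_chart d (hne _) (hne _))
  obtain ⟨o, ho⟩ := hd
  have := PiecewiseLiftable.of_deformation (isQuotientMap_cell h) (isOpen_chart g r o)
    (fun d d' hdd => chart_saturated o ((cell_eq_iff h).1 hdd)) (deform g r o)
    (fun d hd t => continuousAt_deform o hd t) (fun d _ => deform_zero o d)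
    (fun d d' hdd hd t => (cell_eq_iff h).2 (proj_deform o ((cell_eq_iff h).1 hdd) hd t))
    (fun d hd => eventually_deform_one o hd)
  exact ⟨_, this.1, ⟨d, ho, rfl⟩, this.2⟩

end Surface

namespace Surface

variable {g r : ℕ} {G : Type*} [Group G]

/-! ### Flat bundles from gluing data -/

/-- The locally constant frames with given values near the vertices (`v false`) and near the
sides (`v true`). -/
noncomputable def frame (g r : ℕ) (v : Bool → ℕ → G) : Option Bool → Disc → G
  | none, _ => 1
  | some b, d => v b (sectorIndex (numSides g r) (shift b) d % numSides g r).toNat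

/-- The index `n` is allowed because the end of the last side lies in the sector of vertex `0`. -/
theorem toNat_index_emod {n k : ℕ} {i m : ℤ} (hk : k ≤ n) (h : i = k + n * m) :
    (i % n).toNat = if k = n then 0 else k := by
  rw [h, Int.add_mul_emod_self_left]
  split_ifs with hkn
  · rw [hkn]
    simp
  · rw [Int.emod_eq_of_lt (by omega) (by omega)]
    simp

theorem frame_side {v : Bool → ℕ → G} (b : Bool) {k l : ℕ} {t : I}
    (h1 : (l : ℝ) < (k : ℝ) + t - shift b) (h2 : (k : ℝ) + t - shift b < l + 1)
    (hl : l ≤ numSides g r) (hv : l = numSides g r → v b l = v b 0) :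
    frame g r v (some b) (side g r k t) = v b l := by
  obtain ⟨-, m, hm⟩ := inSector_polar (numSides_ne_zero g r) one_pos (k := l)
    (s := shift b) (θ := k + t) (by push_cast; linarith) (by push_cast; linarith)
  rw [frame, coe_side, toNat_index_emod hl hm]
  split_ifs with h
  · exact (hv h).symm
  · rfl

theorem frame_side_of_lt {v : Bool → ℕ → G} {k : ℕ} {t : I} (ht : (t : ℝ) < 1 / 2)
    (hk : k ≤ numSides g r) (hv : v false (numSides g r) = v false 0) :
    frame g r v (some false) (side g r k t) = v false k := by
  have := t.2.1
  refine frame_side false ?_ ?_ hk fun h => by rw [h, hv]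
  · norm_num [shift]
    linarith
  · norm_num [shift]
    linarith

theorem frame_side_of_gt {v : Bool → ℕ → G} {k : ℕ} {t : I} (ht : 1 / 2 < (t : ℝ))
    (hk : k < numSides g r) (hv : v false (numSides g r) = v false 0) :
    frame g r v (some false) (side g r k t) = v false (k + 1) := by
  have := t.2.2
  refine frame_side false ?_ ?_ hk fun h => by rw [h, hv]
  · norm_num [shift]
    linarith
  · norm_num [shift]
    linarith

theorem frame_true_side {v : Bool → ℕ → G} {k : ℕ} {t : I} (ht : 0 < (t : ℝ)) (ht' : (t : ℝ) < 1)
    (hk : k < numSides g r) : frame g r v (some true) (side g r k t) = v true k := by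
  refine frame_side true ?_ ?_ hk.le fun h => absurd h hk.ne
  · simp only [shift, if_true]
    linarith
  · simp only [shift, if_true]
    linarith

/-- Two systems of frames are compatible with the gluing. -/
theorem frame_compat_side {v : Bool → ℕ → G} (hv : v false (numSides g r) = v false 0)
    (hglue : ∀ k k', Paired g r k k' →
      v false k * (v true k)⁻¹ = v false (k' + 1) * (v true k')⁻¹ ∧
      v false (k + 1) * (v true k)⁻¹ = v false k' * (v true k')⁻¹) {k k' : ℕ} {t : I}
    (hk : Paired g r k k') (h0 : side g r k t ∈ chart g r (some false))
    (h1 : side g r k t ∈ chart g r (some true)) :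
    frame g r v (some false) (side g r k t) * (frame g r v (some true) (side g r k t))⁻¹ =
      frame g r v (some false) (side g r k' (σ t)) *
        (frame g r v (some true) (side g r k' (σ t)))⁻¹ := by
  rw [side_mem_chart_iff] at h0 h1
  have e0 : (t : ℝ) ≠ 0 := by
    have := h1 0
    simpa [shift] using this
  have e1 : (t : ℝ) ≠ 1 := by
    have := h1 1
    simpa [shift] using this
  have e2 : (t : ℝ) ≠ 1 / 2 := by
    intro h
    refine h0 1 ?_
    rw [h]
    norm_num [shift]
  have t0 : 0 < (t : ℝ) := lt_of_le_of_ne t.2.1 e0.symm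
  have t1 : (t : ℝ) < 1 := lt_of_le_of_ne t.2.2 e1
  have hs := unitInterval.coe_symm_eq t
  rw [frame_true_side t0 t1 hk.lt.1, frame_true_side (by rw [hs]; linarith) (by rw [hs]; linarith)
    hk.lt.2]
  -- The first half of side `k` lies near its first vertex and is glued to the half of side `k'`
  -- near its last vertex. The two halves give the two gluing equations.
  rcases lt_or_gt_of_ne e2 with ht | ht
  · rw [frame_side_of_lt ht hk.lt.1.le hv, frame_side_of_gt (by rw [hs]; linarith) hk.lt.2 hv]
    exact (hglue k k' hk).1
  · rw [frame_side_of_gt ht hk.lt.1 hv, frame_side_of_lt (by rw [hs]; linarith) hk.lt.2.le hv]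
    exact (hglue k k' hk).2

theorem frame_compat {v : Bool → ℕ → G} (hv : v false (numSides g r) = v false 0)
    (hglue : ∀ k k', Paired g r k k' →
      v false k * (v true k)⁻¹ = v false (k' + 1) * (v true k')⁻¹ ∧
      v false (k + 1) * (v true k)⁻¹ = v false k' * (v true k')⁻¹) (o o' : Option Bool)
    {d d' : Disc} (h : proj g r d = proj g r d') (hd : d ∈ chart g r o) (hd' : d ∈ chart g r o') :
    frame g r v o' d * (frame g r v o d)⁻¹ = frame g r v o' d' * (frame g r v o d')⁻¹ := by
  classical
  have := eq_of_proj_eq (fun d => if d ∈ chart g r o ∧ d ∈ chart g r o' then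
      frame g r v o' d * (frame g r v o d)⁻¹ else 1) (fun k k' t hk => ?_) h
  · simpa [hd, hd', chart_saturated o h hd, chart_saturated o' h hd'] using this
  · have hn : ∀ k t, side g r k t ∉ chart g r none := by
      intro k t
      simp [chart, norm_side]
    rcases o with _ | b
    · simp [hn]
    rcases o' with _ | b'
    · simp [hn]
    simp only [side_symm_mem_chart_iff (k := k') (k' := k)]
    refine if_ctx_congr Iff.rfl (fun hm => ?_) fun _ => rfl
    cases b <;> cases b'
    · simp
    · have := frame_compat_side hv hglue hk hm.1 hm.2
      have h2 := congrArg (·⁻¹) this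
      simpa using h2
    · exact frame_compat_side hv hglue hk hm.2 hm.1
    · simp

theorem eventually_frame_eq (v : Bool → ℕ → G) (o : Option Bool) {d : Disc}
    (hd : d ∈ chart g r o) : ∀ᶠ d' in 𝓝 d, frame g r v o d' = frame g r v o d := by
  cases o with
  | none => exact Eventually.of_forall fun _ => rfl
  | some b =>
    have := (continuous_subtype_val.tendsto d).eventually
      (eventually_inSector (numSides_ne_zero g r) hd)
    filter_upwards [this] with d' hd'
    obtain ⟨-, m, hm⟩ := hd'
    rw [frame, frame, hm, Int.add_mul_emod_self_left]

theorem vertex_mem_chart (k : ℕ) : side g r k 0 ∈ chart g r (some false) := by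
  rw [side_mem_chart_iff]
  intro m hm
  norm_num [shift] at hm
  have h2 : ((2 * m : ℤ) : ℝ) = ((1 : ℤ) : ℝ) := by
    push_cast
    linarith
  have := Int.cast_injective h2
  omega

variable {X : Type*} [TopologicalSpace X] (h : Standard g r ≃ₜ X)

/-- The flat bundle with given gluing data. -/
theorem exists_pathHom {v : Bool → ℕ → G} (hv : v false (numSides g r) = v false 0)
    (hglue : ∀ k k', Paired g r k k' →
      v false k * (v true k)⁻¹ = v false (k' + 1) * (v true k')⁻¹ ∧
      v false (k + 1) * (v true k)⁻¹ = v false k' * (v true k')⁻¹) :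
    ∃ F : PathHom X G, ∀ k l, k ≤ numSides g r → l ≤ numSides g r →
      ∀ δ : Path (side g r k 0) (side g r l 0),
        F.onPath (δ.map (isQuotientMap_cell h).continuous) = v false l * (v false k)⁻¹ := by
  classical
  -- Preferring the vertex chart makes the frame at every vertex the one given by `v false`.
  let i : X → Option Bool := fun x =>
    if ∃ d, cell h d = x ∧ d ∈ chart g r (some false) then some false
    else if ∃ d, cell h d = x ∧ d ∈ chart g r (some true) then some true else none
  have hi : ∀ d, d ∈ chart g r (i (cell h d)) := by
    intro d
    by_cases h0 : d ∈ chart g r (some false)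
    · have : i (cell h d) = some false := if_pos ⟨d, rfl, h0⟩
      rwa [this]
    have h0' : ¬ ∃ d', cell h d' = cell h d ∧ d' ∈ chart g r (some false) := fun ⟨d', e, hd'⟩ =>
      h0 (chart_saturated _ ((cell_eq_iff h).1 e) hd')
    by_cases h1 : d ∈ chart g r (some true)
    · have : i (cell h d) = some true := (if_neg h0').trans (if_pos ⟨d, rfl, h1⟩)
      rwa [this]
    have h1' : ¬ ∃ d', cell h d' = cell h d ∧ d' ∈ chart g r (some true) := fun ⟨d', e, hd'⟩ =>
      h1 (chart_saturated _ ((cell_eq_iff h).1 e) hd')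
    have : i (cell h d) = none := (if_neg h0').trans (if_neg h1')
    rw [this]
    exact exists_mem_chart d h0 h1
  have hiv : ∀ k, i (cell h (side g r k 0)) = some false := fun k =>
    if_pos ⟨_, rfl, vertex_mem_chart k⟩
  obtain ⟨F, hF⟩ := exists_pathHom_of_frames (isQuotientMap_cell h) (chart g r) (isOpen_chart g r)
    (fun o d d' e => chart_saturated o ((cell_eq_iff h).1 e)) i hi (frame g r v)
    (fun o d hd => eventually_frame_eq v o hd)
    (fun o o' d d' e => frame_compat hv hglue o o' ((cell_eq_iff h).1 e))
    (piecewiseLiftable h)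
  refine ⟨F, fun k l hk hl δ => ?_⟩
  rw [hF, hiv, hiv, frame_side_of_lt (by norm_num) hl hv, frame_side_of_lt (by norm_num) hk hv]

end Surface

namespace PathHom

variable {X G : Type*} [TopologicalSpace X] [Group G]

/-- Conjugation by a constant. -/
def conj (F : PathHom X G) (c : G) : PathHom X G where
  hol p := c * F.hol p * c⁻¹
  hol_trans p q := by
    rw [F.hol_trans]
    group

theorem conj_onPath (F : PathHom X G) (c : G) {x y : X} (p : Path x y) :
    (F.conj c).onPath p = c * F.onPath p * c⁻¹ := rfl

end PathHom

namespace Surface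

variable {g r : ℕ}

/-! ### Vertices -/

/-- The index of the vertex that represents the class of the `k`-th vertex under the gluing. -/
def rep (g k : ℕ) : ℕ :=
  if k = 1 then 1 else if k < 2 + 4 * g then 0 else
    if (k - (2 + 4 * g)) % 3 = 0 then 0 else 2 + 4 * g + 3 * ((k - (2 + 4 * g)) / 3) + 1

theorem rep_rep (g k : ℕ) : rep g (rep g k) = rep g k := by
  unfold rep
  split_ifs <;> omega

theorem rep_zero (g : ℕ) : rep g 0 = 0 := by
  unfold rep
  split_ifs <;> omega

theorem rep_one (g : ℕ) : rep g 1 = 1 := rfl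

theorem rep_numSides (g r : ℕ) : rep g (numSides g r) = 0 := by
  unfold rep numSides
  split_ifs <;> omega

theorem rep_boundary (g j : ℕ) : rep g (2 + 4 * g + 3 * j + 1) = 2 + 4 * g + 3 * j + 1 := by
  unfold rep
  split_ifs <;> omega

theorem rep_boundary' (g j : ℕ) : rep g (2 + 4 * g + 3 * j + 2) = 2 + 4 * g + 3 * j + 1 := by
  unfold rep
  split_ifs <;> omega

theorem Paired.rep_eq {k k' : ℕ} (h : Paired g r k k') :
    rep g k = rep g (k' + 1) ∧ rep g (k + 1) = rep g k' := by
  unfold rep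
  cases h with
  | s => constructor <;> split_ifs <;> omega
  | a i => constructor <;> split_ifs <;> omega
  | b i => constructor <;> split_ifs <;> omega
  | c j => constructor <;> split_ifs <;> omega

theorem Paired.proj_vertex {k k' : ℕ} (h : Paired g r k k') :
    proj g r (side g r k 0) = proj g r (side g r (k' + 1) 0) ∧
      proj g r (side g r (k + 1) 0) = proj g r (side g r k' 0) := by
  constructor
  · rw [proj_side_eq h, unitInterval.symm_zero, side_one]
  · rw [← side_one, proj_side_eq h, unitInterval.symm_one]

theorem side_numSides (g r : ℕ) : side g r (numSides g r) 0 = side g r 0 0 := by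
  apply Subtype.ext
  rw [coe_side, coe_side]
  congr 1
  rw [circ_eq_circ_iff (numSides_ne_zero g r)]
  exact ⟨1, by simp⟩

theorem proj_vertex_handle (i : ℕ) (hi : i ≤ g) :
    proj g r (side g r (2 + 4 * i) 0) = proj g r (side g r 0 0) := by
  induction i with
  | zero => exact (Paired.s (g := g) (r := r)).proj_vertex.1.symm
  | succ i ih =>
    have ha := (Paired.a (r := r) (⟨i, hi⟩ : Fin g)).proj_vertex
    have hb := (Paired.b (r := r) (⟨i, hi⟩ : Fin g)).proj_vertex
    dsimp only at ha hb
    rw [← ih (by omega), ha.1, ← hb.2, show 2 + 4 * i + 1 + 1 = 2 + 4 * i + 2 by omega, ← ha.2, hb.1]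
    rfl

theorem proj_vertex_boundary (j : ℕ) (hj : j ≤ r) :
    proj g r (side g r (2 + 4 * g + 3 * j) 0) = proj g r (side g r 0 0) := by
  induction j with
  | zero => exact proj_vertex_handle g le_rfl
  | succ j ih =>
    have hc := (Paired.c (g := g) (⟨j, hj⟩ : Fin r)).proj_vertex
    dsimp only at hc
    rw [← ih (by omega), hc.1]
    rfl

/-- The indices of the vertices. -/
theorem vertex_cases {k : ℕ} (hk : k ≤ numSides g r) :
    k = 0 ∨ k = 1 ∨ (∃ i < g, ∃ e < 4, k = 2 + 4 * i + e) ∨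
      (∃ j < r, ∃ e < 3, k = 2 + 4 * g + 3 * j + e) ∨ k = numSides g r := by
  unfold numSides at *
  by_cases h0 : k < 2
  · omega
  by_cases h1 : k < 2 + 4 * g
  · exact Or.inr (Or.inr (Or.inl ⟨(k - 2) / 4, by omega, (k - 2) % 4, by omega, by omega⟩))
  by_cases h2 : k < 2 + 4 * g + 3 * r
  · exact Or.inr (Or.inr (Or.inr (Or.inl
      ⟨(k - (2 + 4 * g)) / 3, by omega, (k - (2 + 4 * g)) % 3, by omega, by omega⟩)))
  · omega

/-- The representatives are vertex `0`, the tip of `s`, and the start of each boundary side; chains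
of gluings connect the other vertices to these. -/
theorem proj_rep {k : ℕ} (hk : k ≤ numSides g r) :
    proj g r (side g r (rep g k) 0) = proj g r (side g r k 0) := by
  rcases vertex_cases hk with rfl | rfl | ⟨i, hi, e, he, rfl⟩ | ⟨j, hj, e, he, rfl⟩ | rfl
  · rw [rep_zero]
  · rw [rep_one]
  · have hr : rep g (2 + 4 * i + e) = 0 := by
      unfold rep
      split_ifs <;> omega
    have ha := (Paired.a (r := r) (⟨i, hi⟩ : Fin g)).proj_vertex
    have hb := (Paired.b (r := r) (⟨i, hi⟩ : Fin g)).proj_vertex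
    dsimp only at ha hb
    rw [hr, ← proj_vertex_handle i hi.le]
    interval_cases e
    · rfl
    · rw [ha.1, ha.2]
      exact hb.2.symm
    · rw [ha.1]
      exact hb.2.symm
    · exact ha.1
  · have hc := (Paired.c (g := g) (⟨j, hj⟩ : Fin r)).proj_vertex
    dsimp only at hc
    interval_cases e
    · rw [add_zero, show rep g (2 + 4 * g + 3 * j) = 0 by unfold rep; split_ifs <;> omega,
        proj_vertex_boundary j hj.le]
    · rw [rep_boundary]
    · rw [rep_boundary', hc.2]
  · rw [rep_numSides, side_numSides]

/-! ### The holonomy of a flat bundle at the vertices -/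

variable {G : Type*} [Group G] {X : Type*} [TopologicalSpace X] (h : Standard g r ≃ₜ X)

theorem pathConnectedSpace (h : Standard g r ≃ₜ X) : PathConnectedSpace X := by
  have : PathConnectedSpace Disc :=
    (isPathConnected_iff_pathConnectedSpace.1
      ((convex_closedBall (0 : ℂ) 1).isPathConnected ⟨0, by simp⟩))
  exact (isQuotientMap_cell h).surjective.pathConnectedSpace (isQuotientMap_cell h).continuous

theorem contractibleSpace_disc : ContractibleSpace Disc :=
  (convex_closedBall (0 : ℂ) 1).contractibleSpace ⟨0, by simp⟩

/-- A path from the base point to a point of the polygon. -/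
noncomputable def pathTo (d : Disc) : Path (cell h (side g r 0 0)) (cell h d) :=
  haveI := contractibleSpace_disc
  (PathConnectedSpace.somePath (side g r 0 0) d).map (isQuotientMap_cell h).continuous

variable {x : X} (q : Path x (cell h (side g r 0 0)))

/-- The parallel transport from `x` to a point of the polygon. -/
noncomputable def transport (F : PathHom X G) (d : Disc) : G := F.onPath (q.trans (pathTo h d))

variable (F F' : PathHom X G)

/-- The disc is simply connected, so transport inside it depends only on the end points. -/
theorem onPath_map {d d' : Disc} (δ : Path d d') :
    F.onPath (δ.map (isQuotientMap_cell h).continuous) =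
      transport h q F d' * (transport h q F d)⁻¹ := by
  have := contractibleSpace_disc
  have hh : ((PathConnectedSpace.somePath (side g r 0 0) d).trans δ).Homotopic
      (PathConnectedSpace.somePath (side g r 0 0) d') := SimplyConnectedSpace.paths_homotopic _ _
  have h2 := F.onPath_eq_of_homotopic (hh.map ⟨cell h, (isQuotientMap_cell h).continuous⟩)
  rw [Path.map_trans, F.onPath_trans] at h2
  rw [transport, transport, F.onPath_trans, F.onPath_trans]
  change F.onPath (δ.map _) * F.onPath (pathTo h d) = F.onPath (pathTo h d') at h2
  rw [← h2]
  group

/-- The part of a side from its first vertex. -/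
noncomputable def sidePath (g r k : ℕ) (t : I) : Path (side g r k 0) (side g r k t) where
  toFun s := side g r k (s * t)
  continuous_toFun := (continuous_side g r k).comp (by fun_prop)
  source' := by simp
  target' := by simp

/-- The part of a side from its last vertex. -/
noncomputable def sidePathSymm (g r k : ℕ) (t : I) : Path (side g r (k + 1) 0) (side g r k (σ t)) where
  toFun s := side g r k (σ (s * t))
  continuous_toFun := (continuous_side g r k).comp (by fun_prop)
  source' := by simp [side_one]
  target' := by simp

theorem onPath_side_eq {k k' : ℕ} (hk : Paired g r k k') (t : I) :
    transport h q F (side g r k t) * (transport h q F (side g r k 0))⁻¹ =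
      transport h q F (side g r k' (σ t)) * (transport h q F (side g r (k' + 1) 0))⁻¹ := by
  rw [← onPath_map h q F (sidePath g r k t), ← onPath_map h q F (sidePathSymm g r k' t)]
  exact F.onPath_congr _ _ fun s => (cell_eq_iff h).2 (proj_side_eq hk _)

/-- The holonomy along the loop at `x` that passes through the polygon from the vertex `k` to its
representative. -/
noncomputable def vertexHol (k : ℕ) : G :=
  (transport h q F (side g r (rep g k) 0))⁻¹ * transport h q F (side g r k 0)

/-- A vertex and its representative have the same image, so this is the value on a genuine loop at
`x`. -/
theorem vertexHol_eq_of_toHom_eq (hF : F.toHom x = F'.toHom x) {k : ℕ} (hk : k ≤ numSides g r) :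
    vertexHol h q F k = vertexHol h q F' k := by
  have key : ∀ F : PathHom X G, vertexHol h q F k = F.toHom x (Path.Homotopic.Quotient.mk
      ((q.trans (pathTo h (side g r k 0))).trans
        ((q.trans (pathTo h (side g r (rep g k) 0))).cast rfl
          ((cell_eq_iff h).2 (proj_rep hk)).symm).symm)) := by
    intro F
    change _ = F.onPath _
    rw [F.onPath_trans, F.onPath_symm, F.onPath_congr (Path.cast _ _ _)
      (q.trans (pathTo h (side g r (rep g k) 0))) fun _ => rfl]
    rfl
  rw [key, key, hF]

theorem vertexHol_rep (k : ℕ) : vertexHol h q F (rep g k) = 1 := by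
  rw [vertexHol, rep_rep, inv_mul_cancel]

theorem vertexHol_numSides : vertexHol h q F (numSides g r) = 1 := by
  rw [vertexHol, rep_numSides, side_numSides, inv_mul_cancel]

/-- Transports along two glued sides agree, and the factors at the representatives cancel because
glued vertices share them. -/
theorem vertexHol_glue {k k' : ℕ} (hk : Paired g r k k') :
    (vertexHol h q F k)⁻¹ * vertexHol h q F (k' + 1) =
      (vertexHol h q F (k + 1))⁻¹ * vertexHol h q F k' := by
  have h1 := onPath_side_eq h q F hk 1
  rw [unitInterval.symm_one, side_one] at h1
  obtain ⟨e1, e2⟩ := hk.rep_eq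
  simp only [vertexHol, e1, e2]
  rw [mul_inv_eq_iff_eq_mul] at h1
  rw [h1]
  group

/-- The first vertex of a boundary side represents the last one; moving the base point to `x`
through the polygon conjugates the holonomy. -/
theorem onPath_boundaryLoop (j : Fin r) :
    IsConj (F.onPath ((boundaryLoop g r j).map h.continuous))
      (vertexHol h q F (2 + 4 * g + 3 * j + 2)) := by
  have h1 : F.onPath ((boundaryLoop g r j).map h.continuous) =
      F.onPath ((sidePath g r (2 + 4 * g + 3 * j + 1) 1).map (isQuotientMap_cell h).continuous) :=
    F.onPath_congr _ _ fun t => by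
      simp [sidePath, boundaryLoop, cell]
      rfl
  rw [h1, onPath_map h q F, side_one, vertexHol, rep_boundary']
  exact isConj_iff.2 ⟨(transport h q F (side g r (2 + 4 * g + 3 * j + 1) 0))⁻¹, by group⟩

/-- A flat bundle framed at `x` is determined by its holonomy at the vertices. -/
theorem toHom_eq_of_vertexHol_eq
    (hF : ∀ k ≤ numSides g r, vertexHol h q F k = vertexHol h q F' k) :
    F.toHom x = F'.toHom x := by
  -- The gauge transformation from `F` to `F'` over the polygon. Equal vertex holonomies make it
  -- descend to the surface.
  let u : Disc → G := fun d => transport h q F' d * (transport h q F d)⁻¹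
  have hur : ∀ k ≤ numSides g r, u (side g r k 0) = u (side g r (rep g k) 0) := by
    intro k hk
    have h1 := hF k hk
    simp only [vertexHol] at h1
    rw [inv_mul_eq_iff_eq_mul] at h1
    simp only [u]
    rw [h1]
    group
  have hu : ∀ d d', proj g r d = proj g r d' → u d = u d' := by
    intro d d' hd
    refine eq_of_proj_eq u (fun k k' t hk => ?_) hd
    have h1 := onPath_side_eq h q F hk t
    have h2 := onPath_side_eq h q F' hk t
    have h3 : u (side g r k 0) = u (side g r (k' + 1) 0) := by
      rw [hur k hk.lt.1.le, hur (k' + 1) hk.lt.2, hk.rep_eq.1]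
    have e : ∀ d d₀, u d = (transport h q F' d * (transport h q F' d₀)⁻¹) * u d₀ *
        (transport h q F d * (transport h q F d₀)⁻¹)⁻¹ := by
      intro d d₀
      simp only [u]
      group
    rw [e _ (side g r k 0), e (side g r k' (σ t)) (side g r (k' + 1) 0), h1, h2, h3]
  have key : ∀ {y z : X} (p : Path.Homotopic.Quotient y z) (d d' : Disc), cell h d = y →
      cell h d' = z → F'.hol p = u d' * F.hol p * (u d)⁻¹ := by
    intro y z p
    induction piecewiseLiftable h p with
    | @map e e' δ =>
      intro d d' hd hd'
      rw [hu d e ((cell_eq_iff h).1 hd), hu d' e' ((cell_eq_iff h).1 hd')]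
      change F'.onPath _ = u e' * F.onPath _ * _
      rw [onPath_map h q F', onPath_map h q F]
      simp only [u]
      group
    | @trans y w z p p' _ _ ih ih' =>
      intro d d' hd hd'
      obtain ⟨e, he⟩ := (isQuotientMap_cell h).surjective w
      rw [F'.hol_trans, F.hol_trans, ih d e hd he, ih' e d' he hd']
      group
  obtain ⟨d, hd⟩ := (isQuotientMap_cell h).surjective x
  -- On the loop `c` through `d`, the value of `F'` is `u d` times that of `F` by definition, and
  -- its conjugate by `u d` by `key`. Hence the framing at `x` is preserved.
  have hud : u d = 1 := by
    let c : Path x x := (q.trans (pathTo h d)).cast rfl hd.symm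
    have h1 : F'.onPath c = u d * F.onPath c * (u d)⁻¹ := key _ d d hd hd
    have hc : ∀ F : PathHom X G, F.onPath c = transport h q F d := fun F =>
      F.onPath_congr _ _ fun _ => rfl
    have h2 : u d = F'.onPath c * (F.onPath c)⁻¹ := by rw [hc, hc]
    rw [h1] at h2
    have h3 : F.onPath c * (u d)⁻¹ * (F.onPath c)⁻¹ = 1 := by
      have : u d * (F.onPath c * (u d)⁻¹ * (F.onPath c)⁻¹) = u d * 1 := by
        rw [mul_one]
        simpa [mul_assoc] using h2.symm
      exact mul_left_cancel this
    rw [conj_eq_one_iff] at h3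
    exact inv_eq_one.1 h3
  ext p
  have := key p d d hd hd
  rw [hud] at this
  change F.hol p = F'.hol p
  simpa using this.symm

/-- Every system of elements of `G` at the vertices that satisfies the relations given by the
gluing is the holonomy of a flat bundle. -/
theorem exists_vertexHol_eq (α β : ℕ → G) (hα : ∀ k ≤ numSides g r, α (rep g k) = 1)
    (hn : α (numSides g r) = 1)
    (hglue : ∀ k k', Paired g r k k' →
      α k * (β k)⁻¹ = α (k' + 1) * (β k')⁻¹ ∧ α (k + 1) * (β k)⁻¹ = α k' * (β k')⁻¹) :
    ∃ F : PathHom X G, ∀ k ≤ numSides g r, vertexHol h q F k = α k := by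
  have h0 : α 0 = 1 := by
    have := hα 0 (Nat.zero_le _)
    rwa [rep_zero] at this
  obtain ⟨F, hF⟩ := exists_pathHom h (v := fun b => if b then β else α) (by simp [hn, h0])
    (by simpa using hglue)
  have := contractibleSpace_disc
  have h1 : ∀ k ≤ numSides g r, transport h q F (side g r k 0) = α k * F.onPath q := by
    intro k hk
    rw [transport, F.onPath_trans]
    have h2 := hF 0 k (Nat.zero_le _) hk (PathConnectedSpace.somePath _ _)
    simp only [Bool.false_eq_true, if_false, h0, inv_one, mul_one] at h2
    rw [← h2]
    rfl
  have hrep : ∀ k ≤ numSides g r, rep g k ≤ numSides g r := by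
    intro k hk
    unfold rep
    unfold numSides at *
    split_ifs <;> omega
  have hc : ∀ d, transport h q (F.conj (F.onPath q)) d =
      F.onPath q * transport h q F d * (F.onPath q)⁻¹ := fun d => F.conj_onPath _ _
  -- The vertex holonomies of `F` are the `α k` conjugated by the inverse of the transport along
  -- `q`; this undoes it.
  refine ⟨F.conj (F.onPath q), fun k hk => ?_⟩
  rw [vertexHol, hc, hc, h1 k hk, h1 _ (hrep k hk), hα k hk]
  group

end Surface

/-! ### Solving the gluing equations around the polygon -/

namespace Surface

variable {G : Type*} [Group G]

/-- The product of the commutators of the first `i` handles. -/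
def handleProd (a b : ℕ → G) : ℕ → G
  | 0 => 1
  | i + 1 => (b i)⁻¹ * (a i)⁻¹ * b i * a i * handleProd a b i

/-- The product of `c` and the first `j` boundary holonomies. -/
def boundaryProd (c : G) (m : ℕ → G) : ℕ → G
  | 0 => c
  | j + 1 => boundaryProd c m j * m j

theorem handleProd_eq (a b : ℕ → G) (i : ℕ) :
    handleProd a b i =
      (List.ofFn fun l : Fin i => (b l)⁻¹ * (a l)⁻¹ * b l * a l).reverse.prod := by
  induction i with
  | zero => simp [handleProd]
  | succ i ih =>
    rw [List.ofFn_succ']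
    simp [handleProd, ih]

theorem boundaryProd_eq (c : G) (m : ℕ → G) (j : ℕ) :
    boundaryProd c m j = c * (List.ofFn fun l : Fin j => m l).prod := by
  induction j with
  | zero => simp [boundaryProd]
  | succ j ih =>
    rw [List.ofFn_succ']
    simp [boundaryProd, ih, mul_assoc]

/-- The relations between the holonomies of a flat bundle at the vertices. -/
structure IsVertexSystem (g r : ℕ) (α : ℕ → G) : Prop where
  rep : ∀ k ≤ numSides g r, α (rep g k) = 1
  numSides : α (numSides g r) = 1
  glue : ∀ k k', Paired g r k k' → (α k)⁻¹ * α (k' + 1) = (α (k + 1))⁻¹ * α k'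

/-- The holonomy along the first side of a handle. -/
def handleA (α : ℕ → G) (i : ℕ) : G := α (2 + 4 * i + 1) * (α (2 + 4 * i))⁻¹

/-- The holonomy along the second side of a handle. -/
def handleB (α : ℕ → G) (i : ℕ) : G := α (2 + 4 * i + 2) * (α (2 + 4 * i + 1))⁻¹

namespace IsVertexSystem

variable {g r : ℕ} {α α' : ℕ → G}

theorem apply_zero (hα : IsVertexSystem g r α) : α 0 = 1 := by
  have := hα.rep 0 (Nat.zero_le _)
  rwa [rep_zero] at this

theorem apply_one (hα : IsVertexSystem g r α) : α 1 = 1 := by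
  have := hα.rep 1 (by unfold Surface.numSides; omega)
  rwa [rep_one] at this

theorem apply_boundary (hα : IsVertexSystem g r α) {j : ℕ} (hj : j < r) :
    α (2 + 4 * g + 3 * j + 1) = 1 := by
  have := hα.rep (2 + 4 * g + 3 * j + 1) (by unfold Surface.numSides; omega)
  rwa [rep_boundary] at this

theorem apply_handle_three (hα : IsVertexSystem g r α) {i : ℕ} (hi : i < g) :
    α (2 + 4 * i + 3) = (handleA α i)⁻¹ * handleB α i * handleA α i * α (2 + 4 * i) := by
  have h1 : (α (2 + 4 * i))⁻¹ * α (2 + 4 * i + 3) = (α (2 + 4 * i + 1))⁻¹ * α (2 + 4 * i + 2) :=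
    hα.glue _ _ (Paired.a (r := r) (⟨i, hi⟩ : Fin g))
  rw [inv_mul_eq_iff_eq_mul] at h1
  rw [h1, handleA, handleB]
  group

theorem apply_handle_four (hα : IsVertexSystem g r α) {i : ℕ} (hi : i < g) :
    α (2 + 4 * (i + 1)) = (handleB α i)⁻¹ * (handleA α i)⁻¹ * handleB α i * handleA α i *
      α (2 + 4 * i) := by
  have h1 : (α (2 + 4 * i + 1))⁻¹ * α (2 + 4 * (i + 1)) =
      (α (2 + 4 * i + 2))⁻¹ * α (2 + 4 * i + 3) :=
    hα.glue _ _ (Paired.b (r := r) (⟨i, hi⟩ : Fin g))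
  rw [inv_mul_eq_iff_eq_mul, hα.apply_handle_three hi] at h1
  rw [h1, handleA, handleB]
  group

theorem apply_boundary_three (hα : IsVertexSystem g r α) {j : ℕ} (hj : j < r) :
    α (2 + 4 * g + 3 * (j + 1)) = α (2 + 4 * g + 3 * j) * α (2 + 4 * g + 3 * j + 2) := by
  have h1 : (α (2 + 4 * g + 3 * j))⁻¹ * α (2 + 4 * g + 3 * (j + 1)) =
      (α (2 + 4 * g + 3 * j + 1))⁻¹ * α (2 + 4 * g + 3 * j + 2) :=
    hα.glue _ _ (Paired.c (g := g) (⟨j, hj⟩ : Fin r))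
  rw [inv_mul_eq_iff_eq_mul, hα.apply_boundary hj, inv_one, one_mul] at h1
  exact h1

theorem apply_handle (hα : IsVertexSystem g r α) {i : ℕ} (hi : i ≤ g) :
    α (2 + 4 * i) = handleProd (handleA α) (handleB α) i := by
  induction i with
  | zero =>
    have h1 : (α 0)⁻¹ * α 2 = (α 1)⁻¹ * α 1 := hα.glue _ _ Paired.s
    rw [hα.apply_zero] at h1
    simpa [handleProd] using h1
  | succ i ih => rw [hα.apply_handle_four hi, ih (by omega), handleProd]

theorem apply_boundary_zero (hα : IsVertexSystem g r α) {j : ℕ} (hj : j ≤ r) :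
    α (2 + 4 * g + 3 * j) = boundaryProd (handleProd (handleA α) (handleB α) g)
      (fun j => α (2 + 4 * g + 3 * j + 2)) j := by
  induction j with
  | zero => exact hα.apply_handle le_rfl
  | succ j ih => rw [hα.apply_boundary_three hj, ih (by omega), boundaryProd]

/-- The recursion reaches the last vertex, where the value is `1`. Handle elements are transports
along sides and accumulate on the left; boundary elements are holonomies of loops through the
polygon and accumulate on the right, whence the two orders. -/
theorem relation (hα : IsVertexSystem g r α) :
    (List.ofFn fun i : Fin g => (handleB α i)⁻¹ * (handleA α i)⁻¹ * handleB α i *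
      handleA α i).reverse.prod * (List.ofFn fun j : Fin r => α (2 + 4 * g + 3 * j + 2)).prod =
        1 := by
  rw [← handleProd_eq, ← boundaryProd_eq _ (fun j => α (2 + 4 * g + 3 * j + 2)),
    ← hα.apply_boundary_zero le_rfl]
  exact hα.numSides

theorem apply_eq (hα : IsVertexSystem g r α) (hα' : IsVertexSystem g r α')
    (ha : ∀ i < g, handleA α i = handleA α' i) (hb : ∀ i < g, handleB α i = handleB α' i)
    (hm : ∀ j < r, α (2 + 4 * g + 3 * j + 2) = α' (2 + 4 * g + 3 * j + 2)) :
    ∀ k ≤ Surface.numSides g r, α k = α' k := by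
  have h0 : ∀ i ≤ g, α (2 + 4 * i) = α' (2 + 4 * i) := by
    intro i
    induction i with
    | zero => intro hi; rw [hα.apply_handle hi, hα'.apply_handle hi]; rfl
    | succ i ih =>
      intro hi
      rw [hα.apply_handle_four hi, hα'.apply_handle_four hi, ha i hi, hb i hi, ih (by omega)]
  have h1 : ∀ j ≤ r, α (2 + 4 * g + 3 * j) = α' (2 + 4 * g + 3 * j) := by
    intro j
    induction j with
    | zero => exact fun _ => h0 g le_rfl
    | succ j ih =>
      intro hj
      rw [hα.apply_boundary_three hj, hα'.apply_boundary_three hj, hm j hj, ih (by omega)]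
  have h2 : ∀ i < g, α (2 + 4 * i + 1) = α' (2 + 4 * i + 1) := by
    intro i hi
    have := ha i hi
    rwa [handleA, handleA, h0 i hi.le, mul_left_inj] at this
  intro k hk
  rcases vertex_cases hk with rfl | rfl | ⟨i, hi, e, he, rfl⟩ | ⟨j, hj, e, he, rfl⟩ | rfl
  · rw [hα.apply_zero, hα'.apply_zero]
  · rw [hα.apply_one, hα'.apply_one]
  · interval_cases e
    · exact h0 i hi.le
    · exact h2 i hi
    · have := hb i hi
      rwa [handleB, handleB, h2 i hi, mul_left_inj] at this
    · rw [hα.apply_handle_three hi, hα'.apply_handle_three hi, ha i hi, hb i hi, h0 i hi.le]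
  · interval_cases e
    · exact h1 j hj.le
    · rw [hα.apply_boundary hj, hα'.apply_boundary hj]
    · exact hm j hj
  · rw [hα.numSides, hα'.numSides]

end IsVertexSystem

/-- The vertex system with given holonomies along the handles and the boundary circles. -/
def vertexSystem (g : ℕ) (a b m : ℕ → G) (k : ℕ) : G :=
  if k < 2 then 1 else
    if k < 2 + 4 * g then
      match (k - 2) % 4 with
      | 0 => handleProd a b ((k - 2) / 4)
      | 1 => a ((k - 2) / 4) * handleProd a b ((k - 2) / 4)
      | 2 => b ((k - 2) / 4) * a ((k - 2) / 4) * handleProd a b ((k - 2) / 4)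
      | _ => (a ((k - 2) / 4))⁻¹ * b ((k - 2) / 4) * a ((k - 2) / 4) * handleProd a b ((k - 2) / 4)
    else
      match (k - (2 + 4 * g)) % 3 with
      | 0 => boundaryProd (handleProd a b g) m ((k - (2 + 4 * g)) / 3)
      | 1 => 1
      | _ => m ((k - (2 + 4 * g)) / 3)

section vertexSystem

variable {g r : ℕ} (a b m : ℕ → G)

theorem vertexSystem_boundary_zero (j : ℕ) :
    vertexSystem g a b m (2 + 4 * g + 3 * j) = boundaryProd (handleProd a b g) m j := by
  rw [vertexSystem, if_neg (by omega), if_neg (by omega),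
    show (2 + 4 * g + 3 * j - (2 + 4 * g)) % 3 = 0 by omega,
    show (2 + 4 * g + 3 * j - (2 + 4 * g)) / 3 = j by omega]
  rfl

theorem vertexSystem_boundary_one (j : ℕ) :
    vertexSystem g a b m (2 + 4 * g + 3 * j + 1) = 1 := by
  rw [vertexSystem, if_neg (by omega), if_neg (by omega),
    show (2 + 4 * g + 3 * j + 1 - (2 + 4 * g)) % 3 = 1 by omega]
  rfl

theorem vertexSystem_boundary_two (j : ℕ) :
    vertexSystem g a b m (2 + 4 * g + 3 * j + 2) = m j := by
  rw [vertexSystem, if_neg (by omega), if_neg (by omega),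
    show (2 + 4 * g + 3 * j + 2 - (2 + 4 * g)) % 3 = 2 by omega,
    show (2 + 4 * g + 3 * j + 2 - (2 + 4 * g)) / 3 = j by omega]
  rfl

theorem vertexSystem_handle_zero {i : ℕ} (hi : i ≤ g) :
    vertexSystem g a b m (2 + 4 * i) = handleProd a b i := by
  obtain rfl | hi := hi.eq_or_lt
  · exact vertexSystem_boundary_zero a b m 0
  · rw [vertexSystem, if_neg (by omega), if_pos (by omega),
      show (2 + 4 * i - 2) % 4 = 0 by omega, show (2 + 4 * i - 2) / 4 = i by omega]
    rfl

theorem vertexSystem_handle_one {i : ℕ} (hi : i < g) :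
    vertexSystem g a b m (2 + 4 * i + 1) = a i * handleProd a b i := by
  rw [vertexSystem, if_neg (by omega), if_pos (by omega),
    show (2 + 4 * i + 1 - 2) % 4 = 1 by omega, show (2 + 4 * i + 1 - 2) / 4 = i by omega]
  rfl

theorem vertexSystem_handle_two {i : ℕ} (hi : i < g) :
    vertexSystem g a b m (2 + 4 * i + 2) = b i * a i * handleProd a b i := by
  rw [vertexSystem, if_neg (by omega), if_pos (by omega),
    show (2 + 4 * i + 2 - 2) % 4 = 2 by omega, show (2 + 4 * i + 2 - 2) / 4 = i by omega]
  rfl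

theorem vertexSystem_handle_three {i : ℕ} (hi : i < g) :
    vertexSystem g a b m (2 + 4 * i + 3) = (a i)⁻¹ * b i * a i * handleProd a b i := by
  rw [vertexSystem, if_neg (by omega), if_pos (by omega),
    show (2 + 4 * i + 3 - 2) % 4 = 3 by omega, show (2 + 4 * i + 3 - 2) / 4 = i by omega]
  rfl

/-- The gluing equations hold by construction; the closing relation is needed only at the last
vertex. -/
theorem isVertexSystem_vertexSystem (h1 : boundaryProd (handleProd a b g) m r = 1) :
    IsVertexSystem g r (vertexSystem g a b m) where
  rep k hk := by
    unfold rep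
    split_ifs
    · rfl
    · rfl
    · rfl
    · exact vertexSystem_boundary_one a b m _
  numSides := by
    rw [numSides, vertexSystem_boundary_zero, h1]
  glue k k' hk := by
    cases hk with
    | s =>
      rw [show 1 + 1 = 2 + 4 * 0 from rfl, vertexSystem_handle_zero a b m (Nat.zero_le g)]
      simp [vertexSystem, handleProd]
    | a i =>
      rw [show 2 + 4 * (i : ℕ) + 2 + 1 = 2 + 4 * i + 3 from rfl,
        vertexSystem_handle_zero a b m i.2.le, vertexSystem_handle_one a b m i.2,
        vertexSystem_handle_two a b m i.2, vertexSystem_handle_three a b m i.2]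
      group
    | b i =>
      rw [show 2 + 4 * (i : ℕ) + 3 + 1 = 2 + 4 * (i + 1) from rfl,
        show 2 + 4 * (i : ℕ) + 1 + 1 = 2 + 4 * i + 2 from rfl,
        vertexSystem_handle_zero a b m i.2, vertexSystem_handle_one a b m i.2,
        vertexSystem_handle_two a b m i.2, vertexSystem_handle_three a b m i.2, handleProd]
      group
    | c j =>
      rw [show 2 + 4 * g + 3 * (j : ℕ) + 2 + 1 = 2 + 4 * g + 3 * (j + 1) from rfl,
        vertexSystem_boundary_zero, vertexSystem_boundary_zero, vertexSystem_boundary_one,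
        vertexSystem_boundary_two, boundaryProd]
      group

theorem handleA_vertexSystem {i : ℕ} (hi : i < g) :
    handleA (vertexSystem g a b m) i = a i := by
  rw [handleA, vertexSystem_handle_zero a b m hi.le, vertexSystem_handle_one a b m hi,
    mul_inv_cancel_right]

theorem handleB_vertexSystem {i : ℕ} (hi : i < g) :
    handleB (vertexSystem g a b m) i = b i := by
  rw [handleB, vertexSystem_handle_two a b m hi, vertexSystem_handle_one a b m hi]
  group

end vertexSystem

/-- A system of correction terms at the sides that makes a vertex system compatible with the
gluing. -/
theorem IsVertexSystem.exists_sides {g r : ℕ} {α : ℕ → G} (hα : IsVertexSystem g r α) :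
    ∃ β : ℕ → G, ∀ k k', Paired g r k k' →
      α k * (β k)⁻¹ = α (k' + 1) * (β k')⁻¹ ∧ α (k + 1) * (β k)⁻¹ = α k' * (β k')⁻¹ := by
  -- The correction is `1` on the first side of each pair and is solved from the first equation on
  -- the second side; `glue` then yields the second equation.
  let β : ℕ → G := fun l =>
    if l = 1 then (α 0)⁻¹ * α 2 else
      if l < 2 + 4 * g then if 2 ≤ (l - 2) % 4 then (α (l - 2))⁻¹ * α (l + 1) else 1
      else if (l - (2 + 4 * g)) % 3 = 2 then (α (l - 2))⁻¹ * α (l + 1) else 1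
  have h1 : ∀ k k', Paired g r k k' → β k = 1 ∧ β k' = (α k)⁻¹ * α (k' + 1) := by
    intro k k' hk
    cases hk with
    | s => simp [β]
    | a i =>
      have := i.2
      simp only [β]
      constructor
      · rw [if_neg (by omega), if_pos (by omega), if_neg (by omega)]
      · rw [if_neg (by omega), if_pos (by omega), if_pos (by omega), Nat.add_sub_cancel]
    | b i =>
      have := i.2
      simp only [β]
      constructor
      · rw [if_neg (by omega), if_pos (by omega), if_neg (by omega)]
      · rw [if_neg (by omega), if_pos (by omega), if_pos (by omega)]
        rfl
    | c j =>
      simp only [β]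
      constructor
      · rw [if_neg (by omega), if_neg (by omega), if_neg (by omega)]
      · rw [if_neg (by omega), if_neg (by omega), if_pos (by omega), Nat.add_sub_cancel]
  refine ⟨β, fun k k' hk => ?_⟩
  obtain ⟨e1, e2⟩ := h1 k k' hk
  rw [e1, e2]
  constructor
  · group
  · rw [hα.glue k k' hk]
    group

/-! ### Framed flat bundles as solutions of the surface relation -/

variable {g r : ℕ} {X : Type*} [TopologicalSpace X] (h : Standard g r ≃ₜ X)

theorem isVertexSystem_vertexHol {x : X} (q : Path x (cell h (side g r 0 0))) (F : PathHom X G) :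
    IsVertexSystem g r (vertexHol h q F) where
  rep k _ := vertexHol_rep h q F k
  numSides := vertexHol_numSides h q F
  glue _ _ hk := vertexHol_glue h q F hk

/-- The flat bundles on a surface with prescribed conjugacy classes of boundary holonomies are the
solutions of the defining relation of the fundamental group of the surface. -/
theorem exists_bijective_holonomyHoms (x : X) (ℓ : Fin r → Path x x)
    (hℓ : ∀ j, FreelyHomotopic (ℓ j) ((boundaryLoop g r j).map h.continuous)) (γ : Fin r → G) :
    ∃ f : holonomyHoms ℓ γ →
      {x : (Fin g → G × G) × (∀ j, conjugatesOf (γ j)) //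
        (List.ofFn fun i => (x.1 i).2⁻¹ * (x.1 i).1⁻¹ * (x.1 i).2 * (x.1 i).1).reverse.prod *
          (List.ofFn fun j => (x.2 j : G)).prod = 1}, Function.Bijective f := by
  have := pathConnectedSpace h
  let q : Path x (cell h (side g r 0 0)) := PathConnectedSpace.somePath _ _
  choose F hF using fun φ : FundamentalGroup X x →* G => PathHom.exists_toHom_eq x φ
  have hconj : ∀ (F : PathHom X G) j, IsConj (F.onPath (ℓ j))
      (vertexHol h q F (2 + 4 * g + 3 * j + 2)) := fun F j =>
    (F.isConj_of_freelyHomotopic (hℓ j)).trans (onPath_boundaryLoop h q F j)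
  have happ : ∀ (F : PathHom X G) j,
      F.toHom x (FundamentalGroup.fromPath (Path.Homotopic.Quotient.mk (ℓ j))) =
        F.onPath (ℓ j) := fun _ _ => rfl
  have hmem : ∀ (φ : holonomyHoms ℓ γ) j,
      vertexHol h q (F φ) (2 + 4 * g + 3 * j + 2) ∈ conjugatesOf (γ j) := by
    intro φ j
    have h1 := φ.2 j
    rw [← hF φ.1, happ] at h1
    exact IsConj.trans h1 (hconj (F φ) j)
  refine ⟨fun φ => ⟨(fun i => (handleA (vertexHol h q (F φ)) i, handleB (vertexHol h q (F φ)) i),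
    fun j => ⟨_, hmem φ j⟩), (isVertexSystem_vertexHol h q (F φ)).relation⟩, ?_, ?_⟩
  · intro φ φ' he
    simp only [Subtype.mk.injEq, Prod.mk.injEq, funext_iff] at he
    apply Subtype.ext
    rw [← hF φ.1, ← hF φ'.1]
    refine toHom_eq_of_vertexHol_eq h q _ _ ((isVertexSystem_vertexHol h q _).apply_eq
      (isVertexSystem_vertexHol h q _) (fun i hi => ?_) (fun i hi => ?_) (fun j hj => ?_))
    · exact (he.1 ⟨i, hi⟩).1
    · exact (he.1 ⟨i, hi⟩).2
    · exact he.2 ⟨j, hj⟩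
  · rintro ⟨⟨y, z⟩, hyz⟩
    let a : ℕ → G := fun i => if hi : i < g then (y ⟨i, hi⟩).1 else 1
    let b : ℕ → G := fun i => if hi : i < g then (y ⟨i, hi⟩).2 else 1
    let m : ℕ → G := fun j => if hj : j < r then z ⟨j, hj⟩ else 1
    have ha : ∀ i : Fin g, a i = (y i).1 := fun i => dif_pos i.2
    have hb : ∀ i : Fin g, b i = (y i).2 := fun i => dif_pos i.2
    have hm : ∀ j : Fin r, m j = z j := fun j => dif_pos j.2
    have hs : IsVertexSystem g r (vertexSystem g a b m) := by
      apply isVertexSystem_vertexSystem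
      rw [boundaryProd_eq, handleProd_eq]
      simp only [ha, hb, hm]
      exact hyz
    obtain ⟨β, hβ⟩ := hs.exists_sides
    obtain ⟨F', hF'⟩ := exists_vertexHol_eq h q _ β hs.rep hs.numSides hβ
    have hφ : F'.toHom x ∈ holonomyHoms ℓ γ := by
      intro j
      rw [happ]
      have h1 := hconj F' j
      rw [hF' _ (by unfold numSides; omega), vertexSystem_boundary_two, hm] at h1
      exact IsConj.trans (z j).2 h1.symm
    -- The chosen extension of `F'.toHom x` need not be `F'`, but vertex holonomies depend only on
    -- the restriction to loops.
    have hv : ∀ k ≤ numSides g r, vertexHol h q (F (F'.toHom x)) k = vertexSystem g a b m k :=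
      fun k hk => (vertexHol_eq_of_toHom_eq h q _ _ (hF _) hk).trans (hF' k hk)
    refine ⟨⟨F'.toHom x, hφ⟩, ?_⟩
    apply Subtype.ext
    refine Prod.ext (funext fun i => Prod.ext ?_ ?_) (funext fun j => Subtype.ext ?_)
    · rw [← ha, ← handleA_vertexSystem a b m i.2]
      dsimp only
      rw [handleA, handleA, hv _ (by unfold numSides; omega), hv _ (by unfold numSides; omega)]
    · rw [← hb, ← handleB_vertexSystem a b m i.2]
      dsimp only
      rw [handleB, handleB, hv _ (by unfold numSides; omega), hv _ (by unfold numSides; omega)]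
    · rw [← hm, ← vertexSystem_boundary_two (g := g) a b m j]
      exact hv _ (by unfold numSides; omega)

end Surface

theorem mainTheorem2 {G : Type*} [Group G] [Finite G] (g r : ℕ)
    {X : Type*} [TopologicalSpace X] (h : Surface.Standard g r ≃ₜ X)
    (x : X) (ℓ : Fin r → Path x x)
    (hℓ : ∀ j, Surface.FreelyHomotopic (ℓ j) ((Surface.boundaryLoop g r j).map h.continuous))
    (γ : Fin r → G) :
    Finite (IrrepClass G) ∧
    (holonomyHoms ℓ γ).Finite ∧
    ((holonomyHoms ℓ γ).ncard : ℂ) / (Nat.card G : ℂ) =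
      (Nat.card G : ℂ) ^ (2 * (g : ℤ) - 2) *
        (∏ j, ((conjugatesOf (γ j)).ncard : ℂ)) *
        ∑ᶠ π : IrrepClass G,
          (∏ j, π.character (γ j)) / (π.dim : ℂ) ^ (2 * (g : ℤ) - 2 + (r : ℤ)) := by

  have hfin := IrrepClass.finite G
  obtain ⟨f, hf⟩ := Surface.exists_bijective_holonomyHoms h x ℓ hℓ γ
  have hX : Finite (holonomyHoms ℓ γ) := Finite.of_injective f hf.1
  refine ⟨hfin, Set.toFinite _, ?_⟩
  rw [← Nat.card_coe_set_eq, Nat.card_eq_of_bijective f hf]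
  exact card_surfaceRelation g r γ
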